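/- **Setting.** A transaction is a finite sequence of operations, each of which reads a value from, or writes a value to, a variable; it contains at most one write per variable, and no read of a variable is preceded in it by a write to that variable. A (finite) history $h=\langle T,\mathsf{so},\mathsf{wr}\rangle$ consists of a finite set $T$ of transactions, a strict partial order $\mathsf{so}$ on $T$ (session order), and a write-read relation $\mathsf{wr}$ that assigns to every read operation exactly one transaction, which writes the same value to the same variable; $\mathsf{so}\cup\mathsf{wr}$ is acyclic. (We also write $\langle t,t'\rangle\in\mathsf{wr}$, resp. $\mathsf{wr}_x$, if some read in $t'$, resp. some read of $x$ in $t'$, is assigned $t$.) There is a distinguished initial transaction that writes all variables of $h$ and precedes all other transactions in $\mathsf{so}$; on the other transactions $\mathsf{so}$ is a disjoint union of sequences, called sessions, and the initial transaction is regarded as a distinguished session of its own. The history $h$ satisfies a criterion $X$ if there is a strict total order $\mathsf{co}\supseteq\mathsf{wr}\cup\mathsf{so}$ on $T$ such that for every variable $x$ and all $t_1\ne t_2$ and $t_3$ in $T$ with $\langle t_1,t_3\rangle\in\mathsf{wr}_x$ and $t_2$ writing $x$, the relation $\langle t_2,t_1\rangle\in\mathsf{co}$ holds whenever * $X=\mathrm{PC}$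 (prefix consistency): $\langle t_2,t_3\rangle\in \mathsf{co}^*\circ(\mathsf{wr}\cup\mathsf{so})$; * $X=\mathrm{SI}$ (snapshot isolation): the condition for PC holds, or there is $t_4$ such that $t_3$ and $t_4$ write a common variable, $\langle t_2,t_4\rangle\in\mathsf{co}^*$ and $\langle t_4,t_3\rangle\in\mathsf{co}$; * $X=\mathrm{SER}$ (serializability): $\langle t_2,t_3\rangle\in\mathsf{co}$. Here $\circ$ composes from left to right and $\mathsf{co}^*$ is the reflexive transitive closure. The communication graph $\mathsf{Comm}(h)$ is the undirected graph whose vertices are the sessions of $h$, two distinct sessions being adjacent iff they contain transactions that read or write a common variable. A graph is biconnected if it is connected and remains connected when any one vertex is removed; a biconnected component is a maximal biconnected subgraph. **Corollary.** For every fixed $k\in\mathbb N$ and every $X\in\{\mathrm{PC},\mathrm{SI},\mathrm{SER}\}$ there is a polynomial-time algorithm that decides whether a history $h$ satisfies $X$, on all histories $h$ such that every biconnected component of $\mathsf{Comm}(h)$ has at most $k$ vertices. The same holds if the distinguished session of the initial transaction is left out of $\mathsf{Comm}(h)$. The number of sessions of $h$ is not bounded, and the polynomial may depend on $k$ and $X$.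 -/

import Mathlib

/-! ## Histories of transactions -/

/-- An operation reads a value `v` from, or writes a value `v` to, a variable `x`.
Variables and values are named by natural numbers. -/
inductive TxOp
  | read (x v : ℕ)
  | write (x v : ℕ)

/-- A transaction: a finite set of operations with a strict total order (the program order), that
is, a finite sequence; the position of an operation in the sequence is its identifier. -/
abbrev Transaction := List TxOp

namespace Transaction

/-- The transaction writes the variable `x`. -/
def Writes (t : Transaction) (x : ℕ) : Prop := ∃ v, TxOp.write x v ∈ t

/-- The transaction reads the variable `x`. -/
def Reads (t : Transaction) (x : ℕ) : Prop := ∃ v, TxOp.read x v ∈ t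

/-- At most one write to each variable, and no read of a variable is preceded by a write to it. -/
def WellFormed (t : Transaction) : Prop :=
  (∀ (i j x v w : ℕ), t[i]? = some (.write x v) → t[j]? = some (.write x w) → i = j) ∧
  (∀ (i j x v w : ℕ), t[i]? = some (.read x v) → t[j]? = some (.write x w) → i < j)

end Transaction

/-- A history whose transactions are indexed by `T`.  The write-read relation is given by its
inverse, which is a total function: the `i`-th operation of `t`, if it is a read, reads from
`src t i` (the value of `src t i` has no meaning if the `i`-th operation of `t` is not a read). -/
structure History (T : Type) where
  /-- the transactions -/
  txn : T → Transaction
  /-- the session order -/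
  so : T → T → Prop
  /-- the inverse of the write-read relation -/
  src : T → ℕ → T
  /-- the distinguished transaction that writes the initial values -/
  init : T
  wellFormed : ∀ t, (txn t).WellFormed
  so_irrefl : ∀ t, ¬ so t t
  so_trans : ∀ a b c, so a b → so b c → so a c
  src_writes : ∀ (t : T) (i x v : ℕ),
    (txn t)[i]? = some (.read x v) → TxOp.write x v ∈ txn (src t i)
  acyclic : ∀ t, ¬ Relation.TransGen
    (fun a b => so a b ∨ ∃ (i x v : ℕ), (txn b)[i]? = some (.read x v) ∧ src b i = a) t t
  /-- `init` writes all variables (that occur in the history) -/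
  init_writes : ∀ t x, (txn t).Reads x ∨ (txn t).Writes x → (txn init).Writes x
  init_first : ∀ t, t ≠ init → so init t

namespace History

variable {T : Type}

/-- The write-read relation restricted to the variable `x`, extended to transactions. -/
def wrOn (h : History T) (x : ℕ) (a b : T) : Prop :=
  ∃ (i v : ℕ), (h.txn b)[i]? = some (.read x v) ∧ h.src b i = a

/-- The write-read relation, extended to transactions. -/
def wr (h : History T) (a b : T) : Prop := ∃ x, h.wrOn x a b

/-- Transaction `t` writes the variable `x`. -/
def Writes (h : History T) (t : T) (x : ℕ) : Prop := (h.txn t).Writes x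

/-- Transaction `t` reads or writes the variable `x`. -/
def Accesses (h : History T) (t : T) (x : ℕ) : Prop := (h.txn t).Reads x ∨ (h.txn t).Writes x

/-! ### Consistency criteria -/

/-- The axiom `Prefix`. -/
def PrefixAxiom (h : History T) (co : T → T → Prop) : Prop :=
  ∀ (x : ℕ) (t₁ t₂ t₃ : T), t₁ ≠ t₂ → h.wrOn x t₁ t₃ → h.Writes t₂ x →
    (∃ t₄, Relation.ReflTransGen co t₂ t₄ ∧ (h.wr t₄ t₃ ∨ h.so t₄ t₃)) → co t₂ t₁

/-- The axiom `Conflict`. -/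
def ConflictAxiom (h : History T) (co : T → T → Prop) : Prop :=
  ∀ (x y : ℕ) (t₁ t₂ t₃ t₄ : T), t₁ ≠ t₂ → h.wrOn x t₁ t₃ → h.Writes t₂ x →
    h.Writes t₃ y → h.Writes t₄ y → Relation.ReflTransGen co t₂ t₄ → co t₄ t₃ → co t₂ t₁

/-- The axiom `Serializability`. -/
def SerializabilityAxiom (h : History T) (co : T → T → Prop) : Prop :=
  ∀ (x : ℕ) (t₁ t₂ t₃ : T), t₁ ≠ t₂ → h.wrOn x t₁ t₃ → h.Writes t₂ x → co t₂ t₃ → co t₂ t₁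

end History

/-- Prefix consistency, snapshot isolation, serializability. -/
inductive Criterion
  | PC
  | SI
  | SER

/-- The set of axioms that defines a criterion. -/
def Criterion.Axioms {T : Type} (X : Criterion) (h : History T) (co : T → T → Prop) : Prop :=
  match X with
  | .PC => h.PrefixAxiom co
  | .SI => h.PrefixAxiom co ∧ h.ConflictAxiom co
  | .SER => h.SerializabilityAxiom co

namespace History

variable {T : Type}

/-- The history satisfies the criterion `X`: some commit order, a strict total order that contains
the write-read relation and the session order, satisfies the axioms of `X`. -/
def Satisfies (h : History T) (X : Criterion) : Prop :=
  ∃ co : T → T → Prop,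
    (∀ t, ¬ co t t) ∧ (∀ a b c, co a b → co b c → co a c) ∧ (∀ a b, a ≠ b → co a b ∨ co b a) ∧
    (∀ a b, h.wr a b ∨ h.so a b → co a b) ∧ X.Axioms h co

/-! ### Sessions and the communication graph -/

/-- Two transactions are in the same session: they are equal, or they are both different from the
initial transaction and comparable in the session order.  (The initial transaction forms a
distinguished session of its own.) -/
def SameSession (h : History T) (a b : T) : Prop :=
  a = b ∨ (a ≠ h.init ∧ b ≠ h.init ∧ (h.so a b ∨ h.so b a))

/-- Apart from the initial transaction, the session order is a disjoint union of sequences. -/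
def SessionsAreSequences (h : History T) : Prop :=
  ∀ a b c, h.SameSession a b → h.SameSession b c → h.SameSession a c

/-- The session of a transaction, as a set of transactions. -/
def session (h : History T) (t : T) : Set T := {s | h.SameSession t s}

/-- The communication graph: its vertices are the sessions, including the distinguished session of
the initial transaction; two sessions are adjacent iff they contain transactions that access a
common variable. -/
def comm (h : History T) : SimpleGraph {S : Set T // ∃ t, S = h.session t} where
  Adj S S' := S ≠ S' ∧ ∃ t ∈ S.1, ∃ t' ∈ S'.1, ∃ x, h.Accesses t x ∧ h.Accesses t' x
  symm := ⟨fun _ _ ⟨hne, t, ht, t', ht', x, hx, hx'⟩ => ⟨hne.symm, t', ht', t, ht, x, hx', hx⟩⟩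
  loopless := ⟨fun _ hS => hS.1 rfl⟩

/-- The communication graph without the distinguished session of the initial transaction. -/
def properComm (h : History T) :
    SimpleGraph {S : {S : Set T // ∃ t, S = h.session t} | h.init ∉ S.1} :=
  h.comm.induce _

end History

/-- A graph is biconnected if it is connected, and stays connected when any one vertex is removed
(a graph without vertices counts as connected here, so that a single vertex is biconnected). -/
def IsBiconnected {V : Type*} (G : SimpleGraph V) : Prop :=
  G.Connected ∧ ∀ v : V, (G.induce {v}ᶜ).Preconnected

/-- A biconnected component is a maximal biconnected subgraph. -/
def IsBiconnectedComponent {V : Type*} (G : SimpleGraph V) (C : G.Subgraph) : Prop :=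
  Maximal (fun H : G.Subgraph => IsBiconnected H.coe) C

/-- Every biconnected component has at most `k` vertices. -/
def BiconnectedComponentsBounded {V : Type*} (G : SimpleGraph V) (k : ℕ) : Prop :=
  ∀ C : G.Subgraph, IsBiconnectedComponent G C → C.verts.encard ≤ k

/-! ## Histories as inputs -/

/-- A finite history; up to renaming of its transactions, these are numbered `0, …, n - 1`. -/
structure FiniteHistory where
  n : ℕ
  hist : History (Fin n)

/-- An operation, together with the number `s` of the transaction that it reads from, as four
numbers. -/
def TxOp.encode (s : ℕ) : TxOp → List ℕ
  | .read x v => [0, x, v, s]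
  | .write x v => [1, x, v, 0]

open Classical in
/-- A finite history as a list of numbers: the number of transactions, the number of the initial
transaction, the matrix of the session order row by row, and for each transaction the number of
its operations followed by these operations in program order. -/
noncomputable def FiniteHistory.encode (H : FiniteHistory) : List ℕ :=
  [H.n, (H.hist.init : ℕ)] ++
  ((List.finRange H.n).flatMap fun a =>
    (List.finRange H.n).map fun b => if H.hist.so a b then 1 else 0) ++
  ((List.finRange H.n).flatMap fun t =>
    (H.hist.txn t).length ::
      ((H.hist.txn t).mapIdx fun i o => o.encode (H.hist.src t i : ℕ)).flatten)

/-! ## Random-access machines and polynomial time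

A structured random-access machine.  Its memory is a family of arrays of natural numbers (a program
uses finitely many of them), its arithmetic is addition and truncated subtraction.  Every
instruction, test and node of an expression costs one step.  A step at most doubles the largest
number in the memory, so a run of `t` steps only handles numbers with `O(t)` bits more than its
input, and polynomial time on this machine is polynomial time on a Turing machine. -/
namespace RAM

/-- Memory: `m a i` is the `i`-th cell of array `a`. -/
abbrev Mem := ℕ → ℕ → ℕ

/-- Expressions: constants, the cell of array `a` whose address is the value of an expression, sums
and truncated differences. -/
inductive Expr
  | const (c : ℕ)
  | cell (a : ℕ) (addr : Expr)
  | add (e f : Expr)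
  | sub (e f : Expr)

/-- The value of an expression. -/
def Expr.eval (m : Mem) : Expr → ℕ
  | .const c => c
  | .cell a e => m a (e.eval m)
  | .add e f => e.eval m + f.eval m
  | .sub e f => e.eval m - f.eval m

/-- The number of steps that it takes to evaluate an expression. -/
def Expr.cost : Expr → ℕ
  | .const _ => 1
  | .cell _ e => e.cost + 1
  | .add e f => e.cost + f.cost + 1
  | .sub e f => e.cost + f.cost + 1

/-- Programs: `store a i e` stores the value of `e` in the cell of array `a` with address the value
of `i`; a test `e` succeeds iff its value is not `0`. -/
inductive Prog
  | skip
  | store (a : ℕ) (i e : Expr)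
  | seq (p q : Prog)
  | ite (e : Expr) (p q : Prog)
  | while (e : Expr) (p : Prog)

/-- The memory `m` after `v` is stored in cell `i` of array `a`. -/
def Mem.set (m : Mem) (a i v : ℕ) : Mem := Function.update m a (Function.update (m a) i v)

/-- `Exec p m m' t`: started in memory `m`, program `p` halts after `t` steps in memory `m'`. -/
inductive Exec : Prog → Mem → Mem → ℕ → Prop
  | skip (m : Mem) : Exec .skip m m 1
  | store (m : Mem) (a : ℕ) (i e : Expr) :
      Exec (.store a i e) m (m.set a (i.eval m) (e.eval m)) (i.cost + e.cost + 1)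
  | seq {p q : Prog} {m₁ m₂ m₃ : Mem} {t₁ t₂ : ℕ} :
      Exec p m₁ m₂ t₁ → Exec q m₂ m₃ t₂ → Exec (.seq p q) m₁ m₃ (t₁ + t₂)
  | iteTrue {e : Expr} {p q : Prog} {m m' : Mem} {t : ℕ} :
      e.eval m ≠ 0 → Exec p m m' t → Exec (.ite e p q) m m' (e.cost + 1 + t)
  | iteFalse {e : Expr} {p q : Prog} {m m' : Mem} {t : ℕ} :
      e.eval m = 0 → Exec q m m' t → Exec (.ite e p q) m m' (e.cost + 1 + t)
  | whileTrue {e : Expr} {p : Prog} {m₁ m₂ m₃ : Mem} {t₁ t₂ : ℕ} :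
      e.eval m₁ ≠ 0 → Exec p m₁ m₂ t₁ → Exec (.while e p) m₂ m₃ t₂ →
      Exec (.while e p) m₁ m₃ (e.cost + 1 + t₁ + t₂)
  | whileFalse {e : Expr} {p : Prog} {m : Mem} :
      e.eval m = 0 → Exec (.while e p) m m (e.cost + 1)

/-- The initial memory: the input in array `0`, its length in cell `0` of array `1`, and `0` in all
other cells. -/
def input (w : List ℕ) : Mem := fun a i =>
  if a = 0 then w.getD i 0 else if a = 1 ∧ i = 0 then w.length else 0

/-- The property `Q` of the objects `x : α`, given as lists of numbers through `enc`, is decided in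
polynomial time on the objects that satisfy `P`: there are a program and a polynomial `p` such that
on every `x` with `P x` the program halts after at most `p (length of the input)` steps with `1` in
cell `0` of array `2` if `Q x` holds, and with `0` there otherwise. -/
def DecidableInPolyTimeOn {α : Type*} (enc : α → List ℕ) (P Q : α → Prop) : Prop :=
  ∃ (c : Prog) (p : Polynomial ℕ), ∀ x, P x →
    ∃ (m : Mem) (t : ℕ), Exec c (input (enc x)) m t ∧ t ≤ p.eval (enc x).length ∧
      (Q x → m 2 0 = 1) ∧ (¬ Q x → m 2 0 = 0)

/-- The machine is deterministic. -/
theorem Exec.unique {p : Prog} {m m₁ m₂ : Mem} {t₁ t₂ : ℕ} (h₁ : Exec p m m₁ t₁)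
    (h₂ : Exec p m m₂ t₂) : m₁ = m₂ ∧ t₁ = t₂ := by
  induction h₁ generalizing m₂ t₂ with
  | skip => cases h₂; exact ⟨rfl, rfl⟩
  | store => cases h₂; exact ⟨rfl, rfl⟩
  | seq _ _ ih₁ ih₂ =>
    cases h₂ with
    | seq a b =>
      obtain ⟨rfl, rfl⟩ := ih₁ a
      obtain ⟨rfl, rfl⟩ := ih₂ b
      exact ⟨rfl, rfl⟩
  | iteTrue he _ ih =>
    cases h₂ with
    | iteTrue _ a => obtain ⟨rfl, rfl⟩ := ih a; exact ⟨rfl, rfl⟩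
    | iteFalse h _ => exact absurd h he
  | iteFalse he _ ih =>
    cases h₂ with
    | iteTrue h _ => exact absurd he h
    | iteFalse _ a => obtain ⟨rfl, rfl⟩ := ih a; exact ⟨rfl, rfl⟩
  | whileTrue he _ _ ih₁ ih₂ =>
    cases h₂ with
    | whileTrue _ a b =>
      obtain ⟨rfl, rfl⟩ := ih₁ a
      obtain ⟨rfl, rfl⟩ := ih₂ b
      exact ⟨rfl, rfl⟩
    | whileFalse h => exact absurd h he
  | whileFalse he =>
    cases h₂ with
    | whileTrue h _ _ => exact absurd he h
    | whileFalse _ => exact ⟨rfl, rfl⟩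

end RAM

namespace RAM

/-! ## Functions computed in polynomial time -/

theorem Mem.set_self (m : Mem) (a i v : ℕ) : (m.set a i v) a i = v := by
  simp [Mem.set]

theorem Mem.set_of_ne (m : Mem) {a a' : ℕ} (i v : ℕ) (h : a' ≠ a) : (m.set a i v) a' = m a' := by
  simp [Mem.set, h]

theorem Mem.set_cell_of_ne (m : Mem) (a : ℕ) {i j : ℕ} (v : ℕ) (h : j ≠ i) :
    (m.set a i v) a j = m a j := by
  simp [Mem.set, h]

/-- The value of the scalar variable that is stored in cell `0` of array `a`. -/
abbrev Expr.var (a : ℕ) : Expr := .cell a (.const 0)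

/-- The assignment of the value of `e` to the scalar variable `a`. -/
abbrev Prog.assign (a : ℕ) (e : Expr) : Prog := .store a (.const 0) e

/-- Run `body` while the variable `ctr` counts from `0` up to the value of the variable `bnd`. -/
def Prog.for (ctr bnd : ℕ) (body : Prog) : Prog :=
  .seq (.assign ctr (.const 0))
    (.while (.sub (.var bnd) (.var ctr))
      (.seq body (.assign ctr (.add (.var ctr) (.const 1)))))

theorem exec_while {e : Expr} {body : Prog} {B C : ℕ} (Inv : ℕ → Mem → Prop)
    (test : ∀ j m, j ≤ B → Inv j m → (e.eval m ≠ 0 ↔ j < B))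
    (step : ∀ j m, j < B → Inv j m → ∃ m' t, Exec body m m' t ∧ t ≤ C ∧ Inv (j + 1) m')
    (m : Mem) (h0 : Inv 0 m) :
    ∃ m' t, Exec (.while e body) m m' t ∧ t ≤ B * (e.cost + 1 + C) + (e.cost + 1) ∧ Inv B m' := by
  suffices H : ∀ r j m, j + r = B → Inv j m → ∃ m' t, Exec (.while e body) m m' t ∧
      t ≤ r * (e.cost + 1 + C) + (e.cost + 1) ∧ Inv B m' from H B 0 m (by omega) h0
  intro r
  induction r with
  | zero =>
    intro j m hj hI
    have hj' : j = B := by omega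
    subst hj'
    refine ⟨m, _, Exec.whileFalse ?_, by simp, hI⟩
    by_contra hne
    exact lt_irrefl _ ((test _ _ le_rfl hI).1 hne)
  | succ r ih =>
    intro j m hj hI
    obtain ⟨m₁, t₁, h₁, ht₁, hI₁⟩ := step j m (by omega) hI
    obtain ⟨m₂, t₂, h₂, ht₂, hI₂⟩ := ih (j + 1) m₁ (by omega) hI₁
    refine ⟨m₂, _, Exec.whileTrue ((test _ _ (by omega) hI).2 (by omega)) h₁ h₂, ?_, hI₂⟩
    rw [add_mul]
    omega

theorem exec_for {ctr bnd : ℕ} {body : Prog} {B C : ℕ} (hne : bnd ≠ ctr) (Inv : ℕ → Mem → Prop)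
    (stable : ∀ j m v, Inv j m → Inv j (m.set ctr 0 v))
    (step : ∀ j m, j < B → m bnd 0 = B → m ctr 0 = j → Inv j m →
      ∃ m' t, Exec body m m' t ∧ t ≤ C ∧ m' bnd 0 = B ∧ m' ctr 0 = j ∧ Inv (j + 1) m')
    (m : Mem) (hB : m bnd 0 = B) (h0 : Inv 0 m) :
    ∃ m' t, Exec (.for ctr bnd body) m m' t ∧ t ≤ B * (C + 12) + 9 ∧ m' bnd 0 = B ∧ Inv B m' := by
  obtain ⟨m', t, h, ht, hI⟩ := exec_while (e := .sub (.var bnd) (.var ctr))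
    (body := .seq body (.assign ctr (.add (.var ctr) (.const 1)))) (B := B) (C := C + 6)
    (fun j m => m bnd 0 = B ∧ m ctr 0 = j ∧ Inv j m)
    (by
      rintro j m - ⟨h1, h2, -⟩
      simp [Expr.eval, h1, h2]
      omega)
    (by
      rintro j m hj ⟨h1, h2, h3⟩
      obtain ⟨m₁, t₁, e₁, ht₁, k1, k2, k3⟩ := step j m hj h1 h2 h3
      refine ⟨_, _, Exec.seq e₁ (Exec.store _ _ _ _), ?_, ?_, ?_, ?_⟩
      · simp [Expr.cost]
        omega
      · rw [Mem.set_of_ne _ _ _ hne, k1]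
      · simp [Expr.eval, Mem.set_self, k2]
      · exact stable _ _ _ k3)
    (m.set ctr 0 0)
    ⟨by rw [Mem.set_of_ne _ _ _ hne, hB], by rw [Mem.set_self], stable _ _ _ h0⟩
  refine ⟨m', _, Exec.seq (Exec.store _ _ _ _) h, ?_, hI.1, hI.2.2⟩
  simp only [Expr.cost] at ht ⊢
  have : B * (2 + 1 + 1 + 1 + 1 + (C + 6)) = B * (C + 12) := by ring
  simp only [Nat.reduceAdd] at *
  have e : B * (5 + 1 + (C + 6)) = B * (C + 12) := by ring
  omega

variable {α : Type*} (enc : α → List ℕ)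

/-- The memory `m` holds the input `x`. -/
def Holds (x : α) (m : Mem) : Prop := m 0 = input (enc x) 0 ∧ m 1 = input (enc x) 1

variable {enc} in
theorem Holds.congr {x : α} {m m' : Mem} {b : ℕ} (h : Holds enc x m) (hb : 2 ≤ b)
    (hm : ∀ a < b, m' a = m a) : Holds enc x m' :=
  ⟨(hm 0 (by omega)).trans h.1, (hm 1 (by omega)).trans h.2⟩

/-- The program `c` puts the value of `g` into the variable `b`, in time `p`, and does not change
the arrays below `b`. -/
def Evaluates (p : Polynomial ℕ) (c : Prog) (b : ℕ) (g : α → Mem → ℕ) : Prop :=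
  ∀ x m, Holds enc x m → ∃ m' t, Exec c m m' t ∧ t ≤ p.eval (enc x).length ∧
    (∀ a < b, m' a = m a) ∧ m' b 0 = g x m

/-- The function `f` of the input and of `d` numbers is computed in time polynomial in the length of
the input. -/
def PolyFn (d : ℕ) (f : α → (Fin d → ℕ) → ℕ) : Prop :=
  ∃ p : Polynomial ℕ, ∀ (vars : Fin d → ℕ) (b : ℕ), 2 ≤ b → (∀ i, vars i < b) →
    ∃ c, Evaluates enc p c b (fun x m => f x (fun i => m (vars i) 0))

variable {enc} {d : ℕ}

theorem PolyFn.of_expr {f : α → (Fin d → ℕ) → ℕ} (C : ℕ)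
    (h : ∀ vars : Fin d → ℕ, ∃ e : Expr, e.cost ≤ C ∧
      ∀ x m, Holds enc x m → e.eval m = f x (fun i => m (vars i) 0)) : PolyFn enc d f := by
  refine ⟨Polynomial.C (C + 2), fun vars b hb hv => ?_⟩
  obtain ⟨e, he, hf⟩ := h vars
  refine ⟨.assign b e, fun x m hm => ⟨_, _, Exec.store _ _ _ _, ?_, ?_, ?_⟩⟩
  · simp [Expr.cost]
    omega
  · intro a ha
    exact Mem.set_of_ne _ _ _ (by omega)
  · simp only [Expr.eval, Mem.set_self]
    exact hf x m hm

theorem PolyFn.const (c : ℕ) : PolyFn enc d (fun _ _ => c) :=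
  .of_expr 1 fun _ => ⟨.const c, by simp [Expr.cost], fun _ _ _ => rfl⟩

theorem PolyFn.var (i : Fin d) : PolyFn enc d (fun _ v => v i) :=
  .of_expr 2 fun vars => ⟨.var (vars i), by simp [Expr.cost], fun _ _ _ => rfl⟩

theorem PolyFn.length : PolyFn enc d (fun x _ => (enc x).length) :=
  .of_expr 2 fun _ => ⟨.var 1, by simp [Expr.cost], fun x m hm => by
    simp [Expr.eval, hm.2, input]⟩

theorem PolyFn.rename {e : ℕ} {f : α → (Fin d → ℕ) → ℕ} (hf : PolyFn enc d f)
    (σ : Fin d → Fin e) : PolyFn enc e (fun x v => f x (fun i => v (σ i))) := by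
  obtain ⟨p, hp⟩ := hf
  exact ⟨p, fun vars b hb hv => hp (fun i => vars (σ i)) b hb (fun i => hv _)⟩

theorem PolyFn.bind {f : α → (Fin d → ℕ) → ℕ} {g : α → (Fin (d + 1) → ℕ) → ℕ}
    (hf : PolyFn enc d f) (hg : PolyFn enc (d + 1) g) :
    PolyFn enc d (fun x v => g x (Fin.cons (f x v) v)) := by
  obtain ⟨p, hp⟩ := hf
  obtain ⟨q, hq⟩ := hg
  refine ⟨p + (q + Polynomial.C 4), fun vars b hb hv => ?_⟩
  obtain ⟨c₁, h₁⟩ := hp vars b hb hv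
  obtain ⟨c₂, h₂⟩ := hq (Fin.cons b vars) (b + 1) (by omega)
    (Fin.cases (by simp) (fun i => by simpa using (hv i).trans (Nat.lt_succ_self b)))
  refine ⟨.seq c₁ (.seq c₂ (.assign b (.var (b + 1)))), fun x m hm => ?_⟩
  obtain ⟨m₁, t₁, e₁, ht₁, k₁, r₁⟩ := h₁ x m hm
  obtain ⟨m₂, t₂, e₂, ht₂, k₂, r₂⟩ := h₂ x m₁ (hm.congr hb k₁)
  refine ⟨_, _, Exec.seq e₁ (Exec.seq e₂ (Exec.store _ _ _ _)), ?_, ?_, ?_⟩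
  · simp [Expr.cost]
    omega
  · intro a ha
    rw [Mem.set_of_ne _ _ _ (by omega), k₂ a (by omega), k₁ a ha]
  · simp only [Expr.eval, Mem.set_self, r₂]
    congr 1
    ext i
    refine Fin.cases ?_ (fun i => ?_) i
    · simpa using r₁
    · simp [k₁ _ (hv i)]

theorem PolyFn.comp₁ {g : α → (Fin 1 → ℕ) → ℕ} {f : α → (Fin d → ℕ) → ℕ}
    (hg : PolyFn enc 1 g) (hf : PolyFn enc d f) : PolyFn enc d (fun x v => g x ![f x v]) := by
  convert hf.bind (hg.rename ![0]) using 4 with x v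
  ext i; fin_cases i; rfl

theorem PolyFn.comp₂ {g : α → (Fin 2 → ℕ) → ℕ} {f₁ f₂ : α → (Fin d → ℕ) → ℕ}
    (hg : PolyFn enc 2 g) (h₁ : PolyFn enc d f₁) (h₂ : PolyFn enc d f₂) :
    PolyFn enc d (fun x v => g x ![f₁ x v, f₂ x v]) := by
  convert h₁.bind ((h₂.rename Fin.succ).bind (hg.rename ![1, 0])) using 4 with x v
  ext i; fin_cases i <;> rfl

theorem PolyFn.add {f g : α → (Fin d → ℕ) → ℕ} (hf : PolyFn enc d f) (hg : PolyFn enc d g) :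
    PolyFn enc d (fun x v => f x v + g x v) :=
  PolyFn.comp₂ (g := fun _ v => v 0 + v 1) (.of_expr 5 fun vars =>
    ⟨.add (.var (vars 0)) (.var (vars 1)), by simp [Expr.cost], fun _ _ _ => rfl⟩) hf hg

theorem PolyFn.sub {f g : α → (Fin d → ℕ) → ℕ} (hf : PolyFn enc d f) (hg : PolyFn enc d g) :
    PolyFn enc d (fun x v => f x v - g x v) :=
  PolyFn.comp₂ (g := fun _ v => v 0 - v 1) (.of_expr 5 fun vars =>
    ⟨.sub (.var (vars 0)) (.var (vars 1)), by simp [Expr.cost], fun _ _ _ => rfl⟩) hf hg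

theorem PolyFn.cell {f : α → (Fin d → ℕ) → ℕ} (hf : PolyFn enc d f) :
    PolyFn enc d (fun x v => (enc x).getD (f x v) 0) :=
  PolyFn.comp₁ (g := fun x v => (enc x).getD (v 0) 0) (.of_expr 3 fun vars =>
    ⟨.cell 0 (.var (vars 0)), by simp [Expr.cost], fun x m hm => by
      simp [Expr.eval, hm.1, input]⟩) hf

theorem PolyFn.ite {f g h : α → (Fin d → ℕ) → ℕ} (hf : PolyFn enc d f) (hg : PolyFn enc d g)
    (hh : PolyFn enc d h) : PolyFn enc d (fun x v => if f x v ≠ 0 then g x v else h x v) := by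
  obtain ⟨p, hp⟩ := hf
  obtain ⟨q, hq⟩ := hg
  obtain ⟨r, hr⟩ := hh
  refine ⟨p + (q + r + Polynomial.C 3), fun vars b hb hv => ?_⟩
  obtain ⟨c₁, h₁⟩ := hp vars b hb hv
  obtain ⟨c₂, h₂⟩ := hq vars b hb hv
  obtain ⟨c₃, h₃⟩ := hr vars b hb hv
  refine ⟨.seq c₁ (.ite (.var b) c₂ c₃), fun x m hm => ?_⟩
  obtain ⟨m₁, t₁, e₁, ht₁, k₁, r₁⟩ := h₁ x m hm
  have hv₁ : (fun i => m₁ (vars i) 0) = fun i => m (vars i) 0 := by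
    ext i
    rw [k₁ _ (hv i)]
  by_cases hc : f x (fun i => m (vars i) 0) ≠ 0
  · obtain ⟨m₂, t₂, e₂, ht₂, k₂, r₂⟩ := h₂ x m₁ (hm.congr hb k₁)
    refine ⟨_, _, Exec.seq e₁ (Exec.iteTrue (by simpa [Expr.eval, r₁] using hc) e₂), ?_, ?_, ?_⟩
    · simp [Expr.cost]
      omega
    · intro a ha
      rw [k₂ a ha, k₁ a ha]
    · simp only [if_pos hc, r₂, hv₁]
  · obtain ⟨m₂, t₂, e₂, ht₂, k₂, r₂⟩ := h₃ x m₁ (hm.congr hb k₁)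
    refine ⟨_, _, Exec.seq e₁ (Exec.iteFalse (by simpa [Expr.eval, r₁] using hc) e₂), ?_, ?_, ?_⟩
    · simp [Expr.cost]
      omega
    · intro a ha
      rw [k₂ a ha, k₁ a ha]
    · simp only [if_neg hc, r₂, hv₁]

variable (enc) in
/-- The values of `f` are bounded by a polynomial in the length of the input. -/
def PolyBounded (f : α → (Fin d → ℕ) → ℕ) : Prop :=
  ∃ q : Polynomial ℕ, ∀ x v, f x v ≤ q.eval (enc x).length

theorem PolyFn.fold {B z : α → (Fin d → ℕ) → ℕ} {g : α → (Fin (d + 2) → ℕ) → ℕ}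
    (hB : PolyFn enc d B) (hq : PolyBounded enc B) (hz : PolyFn enc d z)
    (hg : PolyFn enc (d + 2) g) :
    PolyFn enc d (fun x v => Nat.rec (motive := fun _ => ℕ) (z x v)
      (fun i acc => g x (Fin.cons acc (Fin.cons i v))) (B x v)) := by
  obtain ⟨pB, hB⟩ := hB
  obtain ⟨q, hq⟩ := hq
  obtain ⟨pz, hz⟩ := hz
  obtain ⟨pg, hg⟩ := hg
  refine ⟨pz + (pB + (q * (pg + Polynomial.C 16) + Polynomial.C 9)), fun vars b hb hv => ?_⟩
  obtain ⟨c₁, h₁⟩ := hz vars b hb hv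
  obtain ⟨c₂, h₂⟩ := hB vars (b + 1) (by omega) (fun i => (hv i).trans (by omega))
  obtain ⟨c₃, h₃⟩ := hg (Fin.cons b (Fin.cons (b + 2) vars)) (b + 3) (by omega)
    (Fin.cases (by simp) (Fin.cases (by simp) (fun i => by
      simpa using (hv i).trans (by omega : b < b + 3))))
  refine ⟨.seq c₁ (.seq c₂ (.for (b + 2) (b + 1) (.seq c₃ (.assign b (.var (b + 3)))))),
    fun x m hm => ?_⟩
  obtain ⟨m₁, t₁, e₁, ht₁, k₁, r₁⟩ := h₁ x m hm
  obtain ⟨m₂, t₂, e₂, ht₂, k₂, r₂⟩ := h₂ x m₁ (hm.congr hb k₁)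
  have hv₁ : (fun i => m₁ (vars i) 0) = fun i => m (vars i) 0 := by
    ext i
    rw [k₁ _ (hv i)]
  simp only [hv₁] at r₂
  set v : Fin d → ℕ := fun i => m (vars i) 0 with hvdef
  obtain ⟨m₃, t₃, e₃, ht₃, -, k₃, r₃⟩ := exec_for (ctr := b + 2) (bnd := b + 1)
    (body := .seq c₃ (.assign b (.var (b + 3)))) (B := B x v) (C := pg.eval (enc x).length + 4)
    (by omega)
    (fun j m' => (∀ a < b, m' a = m a) ∧ m' b 0 = Nat.rec (motive := fun _ => ℕ) (z x v)
      (fun i acc => g x (Fin.cons acc (Fin.cons i v))) j)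
    (by
      rintro j m' w ⟨h, h'⟩
      refine ⟨fun a ha => ?_, ?_⟩
      · rw [Mem.set_of_ne _ _ _ (by omega), h a ha]
      · rw [Mem.set_of_ne _ _ _ (by omega), h'])
    (by
      rintro j m' hj hbnd hctr ⟨h, h'⟩
      obtain ⟨m₄, t₄, e₄, ht₄, k₄, r₄⟩ := h₃ x m' (hm.congr hb h)
      refine ⟨_, _, Exec.seq e₄ (Exec.store _ _ _ _), ?_, ?_, ?_, ?_, ?_⟩
      · simp [Expr.cost]
        omega
      · rw [Mem.set_of_ne _ _ _ (by omega), k₄ _ (by omega), hbnd]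
      · rw [Mem.set_of_ne _ _ _ (by omega), k₄ _ (by omega), hctr]
      · intro a ha
        rw [Mem.set_of_ne _ _ _ (by omega), k₄ _ (by omega), h a ha]
      · simp only [Expr.eval, Mem.set_self, r₄]
        congr 1
        ext i
        refine Fin.cases ?_ (Fin.cases ?_ (fun i => ?_)) i
        · simpa using h'
        · simpa using hctr
        · simp [h _ (hv i), hvdef])
    m₂ r₂ ⟨fun a ha => by rw [k₂ a (by omega), k₁ a ha], (congrFun (k₂ b (by omega)) 0).trans r₁⟩
  refine ⟨m₃, _, Exec.seq e₁ (Exec.seq e₂ e₃), ?_, k₃, r₃⟩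
  simp only [Polynomial.eval_add, Polynomial.eval_mul, Polynomial.eval_C]
  have := Nat.mul_le_mul_right (pg.eval (enc x).length + 4 + 12) (hq x v)
  simp only [add_assoc, Nat.reduceAdd] at *
  omega

end RAM

namespace RAM

variable {α : Type*} {enc : α → List ℕ} {d : ℕ}

variable (enc) in
open Classical in
/-- The relation `R` between the input and `d` numbers is decided in time polynomial in the length
of the input. -/
def PolyRel (d : ℕ) (R : α → (Fin d → ℕ) → Prop) : Prop :=
  PolyFn enc d (fun x v => if R x v then 1 else 0)

/-! ### Reachability -/

/-- One step of the closure of the table `b + 3` under the relation that `c` decides: if the cell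
`b + 5` of the table is marked and related to `b + 6`, then the latter is marked, too. -/
def markStep (b : ℕ) (c : Prog) : Prog :=
  .ite (.cell (b + 3) (.var (b + 5)))
    (.seq c (.ite (.var (b + 7)) (.store (b + 3) (.var (b + 6)) (.const 1)) .skip)) .skip

theorem exec_markStep {b C u w : ℕ} {c : Prog} {m : Mem} {Q : Prop}
    (hu : m (b + 5) 0 = u) (hw : m (b + 6) 0 = w)
    (hc : ∃ m' t, Exec c m m' t ∧ t ≤ C ∧ (∀ a < b + 7, m' a = m a) ∧ (m' (b + 7) 0 ≠ 0 ↔ Q)) :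
    ∃ m' t, Exec (markStep b c) m m' t ∧ t ≤ C + 13 ∧ (∀ a < b + 7, a ≠ b + 3 → m' a = m a) ∧
      ((m' (b + 3) = m (b + 3) ∧ (m (b + 3) u ≠ 0 → ¬ Q)) ∨
        (m (b + 3) u ≠ 0 ∧ Q ∧ m' (b + 3) = Function.update (m (b + 3)) w 1)) := by
  by_cases hm : m (b + 3) u = 0
  · refine ⟨m, _, Exec.iteFalse (by simpa [Expr.eval, hu] using hm) (Exec.skip m), ?_,
      fun _ _ _ => rfl, .inl ⟨rfl, fun h => absurd hm h⟩⟩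
    simp [Expr.cost]
  · obtain ⟨m₁, t₁, e₁, ht₁, k₁, r₁⟩ := hc
    by_cases hQ : Q
    · refine ⟨_, _, Exec.iteTrue (by simpa [Expr.eval, hu] using hm) (Exec.seq e₁
        (Exec.iteTrue (by simpa [Expr.eval] using r₁.2 hQ) (Exec.store _ _ _ _))), ?_, ?_,
        .inr ⟨hm, hQ, ?_⟩⟩
      · simp [Expr.cost]
        omega
      · intro a ha hne
        rw [Mem.set_of_ne _ _ _ hne, k₁ a ha]
      · simp [Mem.set, Expr.eval, k₁, hw]
    · refine ⟨_, _, Exec.iteTrue (by simpa [Expr.eval, hu] using hm) (Exec.seq e₁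
        (Exec.iteFalse (by simpa [Expr.eval] using fun h => hQ (r₁.1 h)) (Exec.skip _))), ?_,
        fun a ha _ => k₁ a ha, .inl ⟨k₁ _ (by omega), fun _ => hQ⟩⟩
      simp [Expr.cost]
      omega

section

variable {b B C s : ℕ} {c : Prog} {E : ℕ → ℕ → Prop} {F : Mem → Prop}

/-- All marked cells are reachable from `s`. -/
def SoundMarks (B s : ℕ) (E : ℕ → ℕ → Prop) (A : ℕ → ℕ) : Prop :=
  ∀ y < B, A y ≠ 0 → A y = 1 ∧ Relation.ReflTransGen (fun a c => a < B ∧ c < B ∧ E a c) s y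

theorem SoundMarks.update {A : ℕ → ℕ} (h : SoundMarks B s E A) {u w : ℕ} (hu : u < B) (hw : w < B)
    (hA : A u ≠ 0) (hE : E u w) : SoundMarks B s E (Function.update A w 1) := by
  intro y hy hne
  by_cases hyw : y = w
  · subst hyw
    exact ⟨by simp, (h u hu hA).2.tail ⟨hu, hw, hE⟩⟩
  · rw [Function.update_of_ne hyw] at hne ⊢
    exact h y hy hne

theorem exec_mark_row {A : ℕ → ℕ} {u : ℕ} (hu : u < B)
    (hF : ∀ m m', F m → (∀ a ≤ b + 5, a ≠ b + 3 → m' a = m a) → F m')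
    (hFu : ∀ m, F m → m b 0 = B ∧ m (b + 5) 0 = u)
    (hc : ∀ m w, F m → m (b + 6) 0 = w → ∃ m' t, Exec c m m' t ∧ t ≤ C ∧
      (∀ a < b + 7, m' a = m a) ∧ (m' (b + 7) 0 ≠ 0 ↔ E u w))
    (m : Mem) (h0 : F m) (hS : SoundMarks B s E (m (b + 3)))
    (hA : ∀ y, A y ≠ 0 → m (b + 3) y ≠ 0) :
    ∃ m' t, Exec (.for (b + 6) b (markStep b c)) m m' t ∧ t ≤ B * (C + 25) + 9 ∧ F m' ∧
      SoundMarks B s E (m' (b + 3)) ∧ (∀ y, m (b + 3) y ≠ 0 → m' (b + 3) y ≠ 0) ∧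
      ∀ w < B, A u ≠ 0 → E u w → m' (b + 3) w ≠ 0 := by
  obtain ⟨m', t, h, ht, -, hI⟩ := exec_for (ctr := b + 6) (bnd := b) (body := markStep b c)
    (B := B) (C := C + 13) (by omega)
    (fun j m' => F m' ∧ SoundMarks B s E (m' (b + 3)) ∧
      (∀ y, m (b + 3) y ≠ 0 → m' (b + 3) y ≠ 0) ∧
      ∀ w < j, A u ≠ 0 → E u w → m' (b + 3) w ≠ 0)
    (by
      rintro j m' w ⟨h1, h2⟩
      refine ⟨hF _ _ h1 fun a ha _ => Mem.set_of_ne _ _ _ (by omega), ?_⟩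
      rwa [Mem.set_of_ne _ _ _ (by omega)])
    (by
      rintro j m₁ hj hB hctr ⟨h1, h2, h3, h4⟩
      obtain ⟨m₂, t₂, e₂, ht₂, k₂, r₂⟩ := exec_markStep (hFu _ h1).2 hctr (hc m₁ j h1 hctr)
      refine ⟨m₂, t₂, e₂, ht₂, by rw [k₂ _ (by omega) (by omega), hB],
        by rw [k₂ _ (by omega) (by omega), hctr],
        hF _ _ h1 fun a ha hne => k₂ a (by omega) hne, ?_⟩
      rcases r₂ with ⟨r, hr⟩ | ⟨hm, hE, r⟩
      · rw [r]
        refine ⟨h2, h3, fun w hw hAu hEw => ?_⟩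
        rcases Nat.lt_succ_iff_lt_or_eq.1 hw with hw | rfl
        · exact h4 w hw hAu hEw
        · exact absurd hEw (hr (h3 _ (hA _ hAu)))
      · rw [r]
        have key : ∀ y, m₁ (b + 3) y ≠ 0 → Function.update (m₁ (b + 3)) j 1 y ≠ 0 := by
          intro y hy
          by_cases hyj : y = j
          · simp [hyj]
          · rwa [Function.update_of_ne hyj]
        refine ⟨h2.update hu hj hm hE, fun y hy => key _ (h3 y hy), fun w hw hAu hEw => ?_⟩
        rcases Nat.lt_succ_iff_lt_or_eq.1 hw with hw | rfl
        · exact key _ (h4 w hw hAu hEw)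
        · simp)
    m (hFu m h0).1 ⟨h0, hS, fun _ h => h, fun w hw => absurd hw (Nat.not_lt_zero _)⟩
  exact ⟨m', t, h, by linarith, hI⟩

theorem exec_mark_round
    (hF : ∀ m m', F m → (∀ a ≤ b + 4, a ≠ b + 3 → m' a = m a) → F m')
    (hFB : ∀ m, F m → m b 0 = B)
    (hc : ∀ m u w, F m → m (b + 5) 0 = u → m (b + 6) 0 = w → ∃ m' t, Exec c m m' t ∧ t ≤ C ∧
      (∀ a < b + 7, m' a = m a) ∧ (m' (b + 7) 0 ≠ 0 ↔ E u w))
    (m : Mem) (h0 : F m) (hS : SoundMarks B s E (m (b + 3))) :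
    ∃ m' t, Exec (.for (b + 5) b (.for (b + 6) b (markStep b c))) m m' t ∧
      t ≤ B * (B * (C + 25) + 21) + 9 ∧ F m' ∧
      SoundMarks B s E (m' (b + 3)) ∧ (∀ y, m (b + 3) y ≠ 0 → m' (b + 3) y ≠ 0) ∧
      ∀ u < B, ∀ w < B, m (b + 3) u ≠ 0 → E u w → m' (b + 3) w ≠ 0 := by
  obtain ⟨m', t, h, ht, -, hI⟩ := exec_for (ctr := b + 5) (bnd := b)
    (body := .for (b + 6) b (markStep b c)) (B := B) (C := B * (C + 25) + 9) (by omega)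
    (fun j m' => F m' ∧ SoundMarks B s E (m' (b + 3)) ∧
      (∀ y, m (b + 3) y ≠ 0 → m' (b + 3) y ≠ 0) ∧
      ∀ u < j, ∀ w < B, m (b + 3) u ≠ 0 → E u w → m' (b + 3) w ≠ 0)
    (by
      rintro j m' w ⟨h1, h2⟩
      refine ⟨hF _ _ h1 fun a ha _ => Mem.set_of_ne _ _ _ (by omega), ?_⟩
      rwa [Mem.set_of_ne _ _ _ (by omega)])
    (by
      rintro j m₁ hj hB hctr ⟨h1, h2, h3, h4⟩
      obtain ⟨m₂, t₂, e₂, ht₂, ⟨k₁, k₂⟩, k₃, k₄, k₅⟩ := exec_mark_row (c := c) (C := C) (b := b)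
        (E := E) (F := fun m' => F m' ∧ m' (b + 5) 0 = j) (A := m (b + 3)) hj
        (fun m m' hm hm' => ⟨hF _ _ hm.1 fun a ha hne => hm' a (by omega) hne,
          by rw [hm' _ le_rfl (by omega), hm.2]⟩)
        (fun m hm => ⟨hFB _ hm.1, hm.2⟩)
        (fun m w hm hw => hc m j w hm.1 hm.2 hw) m₁ ⟨h1, hctr⟩ h2 h3
      refine ⟨m₂, t₂, e₂, ht₂, hFB _ k₁, k₂, k₁, k₃, fun y hy => k₄ y (h3 y hy), ?_⟩
      intro u hu w hw hAu hEw
      rcases Nat.lt_succ_iff_lt_or_eq.1 hu with hu | rfl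
      · exact k₄ _ (h4 u hu w hw hAu hEw)
      · exact k₅ w hw hAu hEw)
    m (hFB m h0) ⟨h0, hS, fun _ h => h, fun w hw => absurd hw (Nat.not_lt_zero _)⟩
  exact ⟨m', t, h, by linarith, hI⟩

open Relation in
theorem exec_mark_rounds (hs : s < B)
    (hF : ∀ m m', F m → (∀ a ≤ b + 2, m' a = m a) → F m')
    (hFB : ∀ m, F m → m b 0 = B)
    (hc : ∀ m u w, F m → m (b + 5) 0 = u → m (b + 6) 0 = w → ∃ m' t, Exec c m m' t ∧ t ≤ C ∧
      (∀ a < b + 7, m' a = m a) ∧ (m' (b + 7) 0 ≠ 0 ↔ E u w))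
    (m : Mem) (h0 : F m) (hS : ∀ y < B, m (b + 3) y = if y = s then 1 else 0) :
    ∃ m' t, Exec (.for (b + 4) b (.for (b + 5) b (.for (b + 6) b (markStep b c)))) m m' t ∧
      t ≤ B * (B * (B * (C + 25) + 21) + 21) + 9 ∧ F m' ∧ ∀ y < B,
        (m' (b + 3) y = 1 ∧ ReflTransGen (fun a c => a < B ∧ c < B ∧ E a c) s y) ∨
        (m' (b + 3) y = 0 ∧ ¬ ReflTransGen (fun a c => a < B ∧ c < B ∧ E a c) s y) := by
  let Closed : (ℕ → ℕ) → Prop := fun A =>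
    ∀ y < B, ReflTransGen (fun a c => a < B ∧ c < B ∧ E a c) s y → A y ≠ 0
  let S : (ℕ → ℕ) → Finset ℕ := fun A => (Finset.range B).filter (A · ≠ 0)
  obtain ⟨m', t, h, ht, -, hI⟩ := exec_for (ctr := b + 4) (bnd := b)
    (body := .for (b + 5) b (.for (b + 6) b (markStep b c))) (B := B)
    (C := B * (B * (C + 25) + 21) + 9) (by omega)
    (fun j m' => F m' ∧ SoundMarks B s E (m' (b + 3)) ∧ m' (b + 3) s ≠ 0 ∧
      (Closed (m' (b + 3)) ∨ j < (S (m' (b + 3))).card))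
    (by
      rintro j m' w ⟨h1, h2⟩
      refine ⟨hF _ _ h1 fun a ha => Mem.set_of_ne _ _ _ (by omega), ?_⟩
      rwa [Mem.set_of_ne _ _ _ (by omega)])
    (by
      rintro j m₁ hj hB hctr ⟨h1, h2, h3, h4⟩
      obtain ⟨m₂, t₂, e₂, ht₂, ⟨k₁, k₂⟩, k₃, k₄, k₅⟩ := exec_mark_round (c := c) (C := C) (b := b)
        (E := E) (B := B) (F := fun m' => F m' ∧ m' (b + 4) 0 = j)
        (fun m m' hm hm' => ⟨hF _ _ hm.1 fun a ha => hm' a (by omega) (by omega),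
          by rw [hm' _ le_rfl (by omega), hm.2]⟩)
        (fun m hm => hFB _ hm.1)
        (fun m u w hm hu hw => hc m u w hm.1 hu hw) m₁ ⟨h1, hctr⟩ h2
      refine ⟨m₂, t₂, e₂, ht₂, hFB _ k₁, k₂, k₁, k₃, k₄ _ h3, ?_⟩
      by_cases hcl : Closed (m₁ (b + 3))
      · exact .inl fun y hy hr => k₄ _ (hcl y hy hr)
      have hlt := h4.resolve_left hcl
      right
      refine (Nat.succ_le_of_lt hlt).trans_lt (Finset.card_lt_card ?_)
      refine ⟨fun y hy => ?_, fun hsub => hcl fun y hy hr => ?_⟩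
      · simp only [S, Finset.mem_filter] at hy ⊢
        exact ⟨hy.1, k₄ _ hy.2⟩
      · induction hr with
        | refl => exact h3
        | tail _ hbc ih =>
          have := k₅ _ hbc.1 _ hbc.2.1 (ih hbc.1) hbc.2.2
          have hmem := hsub (Finset.mem_filter.2 ⟨Finset.mem_range.2 hy, this⟩)
          exact (Finset.mem_filter.1 hmem).2)
    m (hFB m h0)
    ⟨h0, fun y hy hne => by
      rw [hS y hy] at hne ⊢
      by_cases hys : y = s
      · simp [hys, ReflTransGen.refl]
      · simp [hys] at hne, by simp [hS s hs], .inr (Finset.card_pos.2 ⟨s, by simp [S, hs, hS s hs]⟩)⟩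
  obtain ⟨i1, i2, i3, i4⟩ := hI
  refine ⟨m', t, h, by linarith, i1, fun y hy => ?_⟩
  have hcl : Closed (m' (b + 3)) := i4.resolve_right fun hlt => by
    have := Finset.card_filter_le (Finset.range B) (m' (b + 3) · ≠ 0)
    rw [Finset.card_range] at this
    exact absurd hlt (not_lt.2 this)
  by_cases hy0 : m' (b + 3) y = 0
  · exact .inr ⟨hy0, fun hr => hcl y hy hr hy0⟩
  · exact .inl (i2 y hy hy0)

end

open Relation in
theorem PolyRel.reach {B s t : α → (Fin d → ℕ) → ℕ} {E : α → (Fin (d + 2) → ℕ) → Prop}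
    (hB : PolyFn enc d B) (hq : PolyBounded enc B) (hs : PolyFn enc d s) (ht : PolyFn enc d t)
    (hE : PolyRel enc (d + 2) E) (hsB : ∀ x v, s x v < B x v) (htB : ∀ x v, t x v < B x v) :
    PolyRel enc d (fun x v => ReflTransGen
      (fun a c => a < B x v ∧ c < B x v ∧ E x (Fin.cons a (Fin.cons c v))) (s x v) (t x v)) := by
  classical
  obtain ⟨pB, hB⟩ := hB
  obtain ⟨q, hq⟩ := hq
  obtain ⟨ps, hs⟩ := hs
  obtain ⟨pt, ht⟩ := ht
  obtain ⟨pE, hE⟩ := hE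
  refine ⟨pB + (ps + (pt + (q * Polynomial.C 17 + (Polynomial.C 9 + (Polynomial.C 4 +
    (q * (q * (q * (pE + Polynomial.C 25) + Polynomial.C 21) + Polynomial.C 21) +
      Polynomial.C 14)))))), fun vars b hb hv => ?_⟩
  obtain ⟨c₁, h₁⟩ := hB vars b hb hv
  obtain ⟨c₂, h₂⟩ := hs vars (b + 1) (by omega) (fun i => (hv i).trans (by omega))
  obtain ⟨c₃, h₃⟩ := ht vars (b + 2) (by omega) (fun i => (hv i).trans (by omega))
  obtain ⟨c₄, h₄⟩ := hE (Fin.cons (b + 5) (Fin.cons (b + 6) vars)) (b + 7) (by omega)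
    (Fin.cases (by simp) (Fin.cases (by simp) (fun i => by
      simpa using (hv i).trans (by omega : b < b + 7))))
  refine ⟨.seq c₁ (.seq c₂ (.seq c₃ (.seq
    (.for (b + 4) b (.store (b + 3) (.var (b + 4)) (.const 0))) (.seq
    (.store (b + 3) (.var (b + 1)) (.const 1)) (.seq
    (.for (b + 4) b (.for (b + 5) b (.for (b + 6) b (markStep b c₄))))
    (.assign b (.cell (b + 3) (.var (b + 2))))))))), fun x m hm => ?_⟩
  obtain ⟨m₁, t₁, e₁, ht₁, k₁, r₁⟩ := h₁ x m hm
  have l₁ : Holds enc x m₁ := hm.congr hb k₁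
  obtain ⟨m₂, t₂, e₂, ht₂, k₂, r₂⟩ := h₂ x m₁ l₁
  have l₂ : Holds enc x m₂ := l₁.congr hb fun a ha => k₂ a (by omega)
  obtain ⟨m₃, t₃, e₃, ht₃, k₃, r₃⟩ := h₃ x m₂ l₂
  have hv₁ : (fun i => m₁ (vars i) 0) = fun i => m (vars i) 0 := by
    ext i
    rw [k₁ _ (hv i)]
  have hv₂ : (fun i => m₂ (vars i) 0) = fun i => m (vars i) 0 := by
    ext i
    rw [k₂ _ ((hv i).trans (by omega)), k₁ _ (hv i)]
  simp only [hv₁] at r₂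
  simp only [hv₂] at r₃
  simp only at r₁
  set v : Fin d → ℕ := fun i => m (vars i) 0 with hvdef
  let F : Mem → Prop := fun m' =>
    (∀ a < b, m' a = m a) ∧ m' b 0 = B x v ∧ m' (b + 1) 0 = s x v ∧ m' (b + 2) 0 = t x v
  have hF : ∀ m m', F m → (∀ a ≤ b + 2, m' a = m a) → F m' := by
    rintro n n' ⟨f1, f2, f3, f4⟩ h
    refine ⟨fun a ha => (h a (by omega)).trans (f1 a ha), ?_, ?_, ?_⟩
    · rw [h _ (by omega), f2]
    · rw [h _ (by omega), f3]
    · rw [h _ (by omega), f4]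
  have hF₃ : F m₃ := ⟨fun a ha => by rw [k₃ _ (by omega), k₂ _ (by omega), k₁ _ ha],
    by rw [k₃ _ (by omega), k₂ _ (by omega), r₁], by rw [k₃ _ (by omega), r₂], r₃⟩
  obtain ⟨m₄, t₄, e₄, ht₄, -, hF₄, r₄⟩ := exec_for (ctr := b + 4) (bnd := b)
    (body := .store (b + 3) (.var (b + 4)) (.const 0)) (B := B x v) (C := 5) (by omega)
    (fun j m' => F m' ∧ ∀ y < j, m' (b + 3) y = 0)
    (by
      rintro j m' w ⟨h1, h2⟩
      refine ⟨hF _ _ h1 fun a ha => Mem.set_of_ne _ _ _ (by omega), ?_⟩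
      rwa [Mem.set_of_ne _ _ _ (by omega)])
    (by
      rintro j m' hj hbnd hctr ⟨h1, h2⟩
      refine ⟨_, _, Exec.store _ _ _ _, by simp [Expr.cost], ?_, ?_,
        hF _ _ h1 fun a ha => Mem.set_of_ne _ _ _ (by omega), fun y hy => ?_⟩
      · rw [Mem.set_of_ne _ _ _ (by omega), hbnd]
      · rw [Mem.set_of_ne _ _ _ (by omega), hctr]
      · simp only [Expr.eval, hctr]
        by_cases hyj : y = j
        · rw [hyj, Mem.set_self]
        · rw [Mem.set_cell_of_ne _ _ _ hyj, h2 y (by omega)])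
    m₃ hF₃.2.1 ⟨hF₃, fun y hy => absurd hy (Nat.not_lt_zero _)⟩
  obtain ⟨m₆, t₆, e₆, ht₆, hF₆, r₆⟩ := exec_mark_rounds (b := b) (B := B x v) (s := s x v)
    (C := pE.eval (enc x).length) (c := c₄)
    (E := fun a c => E x (Fin.cons a (Fin.cons c v))) (F := F) (hsB x v) hF
    (fun m hm => hm.2.1)
    (by
      intro m' u w hm' hu hw
      obtain ⟨m₄, t₄, e₄, ht₄, k₄, r₄⟩ := h₄ x m' (hm.congr hb hm'.1)
      refine ⟨m₄, t₄, e₄, ht₄, k₄, ?_⟩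
      have : (fun i => m' ((Fin.cons (b + 5) (Fin.cons (b + 6) vars) : Fin (d + 2) → ℕ) i) 0) =
          (Fin.cons u (Fin.cons w v) : Fin (d + 2) → ℕ) := by
        ext i
        refine Fin.cases ?_ (Fin.cases ?_ (fun i => ?_)) i
        · simpa using hu
        · simpa using hw
        · simp [hm'.1 _ (hv i), hvdef]
      rw [r₄]
      simp only [this]
      simp)
    (m₄.set (b + 3) (s x v) 1)
    (hF _ _ hF₄ fun a ha => Mem.set_of_ne _ _ _ (by omega))
    (by
      intro y hy
      by_cases hys : y = s x v
      · simp [hys, Mem.set_self]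
      · simp [hys, Mem.set_cell_of_ne, r₄ y hy])
  have e₅ : Exec (.store (b + 3) (.var (b + 1)) (.const 1)) m₄ (m₄.set (b + 3) (s x v) 1) 4 := by
    have := Exec.store m₄ (b + 3) (.var (b + 1)) (.const 1)
    simpa [Expr.eval, Expr.cost, hF₄.2.2.1] using this
  refine ⟨_, _, Exec.seq e₁ (Exec.seq e₂ (Exec.seq e₃ (Exec.seq e₄ (Exec.seq e₅ (Exec.seq e₆
    (Exec.store _ _ _ _)))))), ?_, ?_, ?_⟩
  · have hBq := hq x v
    simp only [Polynomial.eval_add, Polynomial.eval_mul, Polynomial.eval_C, Expr.cost]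
    generalize Polynomial.eval (enc x).length q = Q at *
    have i1 : B x v * (5 + 12) ≤ Q * 17 := Nat.mul_le_mul hBq le_rfl
    have i2 : B x v * (B x v * (B x v * (pE.eval (enc x).length + 25) + 21) + 21) ≤
        Q * (Q * (Q * (pE.eval (enc x).length + 25) + 21) + 21) := by gcongr
    omega
  · intro a ha
    rw [Mem.set_of_ne _ _ _ (by omega), hF₆.1 a ha]
  · simp only [Expr.eval, Mem.set_self, hF₆.2.2.2]
    rcases r₆ _ (htB x v) with ⟨h, h'⟩ | ⟨h, h'⟩
    · rw [h, if_pos h']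
    · rw [h, if_neg h']

end RAM

namespace RAM

variable {α : Type*} {enc : α → List ℕ} {d : ℕ}

/-! ### Relations decided in polynomial time -/

theorem PolyRel.fn {R : α → (Fin d → ℕ) → Prop} [∀ x v, Decidable (R x v)]
    (h : PolyRel enc d R) : PolyFn enc d (fun x v => if R x v then 1 else 0) := by
  unfold PolyRel at h
  convert h using 4

theorem PolyRel.of_fn {R : α → (Fin d → ℕ) → Prop} {f : α → (Fin d → ℕ) → ℕ}
    (hf : PolyFn enc d f) (h : ∀ x v, R x v ↔ f x v ≠ 0) : PolyRel enc d R := by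
  have := hf.ite (PolyFn.const 1) (PolyFn.const 0)
  unfold PolyRel
  convert this using 4 with x v
  exact h x v

theorem PolyRel.congr {R S : α → (Fin d → ℕ) → Prop} (hR : PolyRel enc d R)
    (h : ∀ x v, S x v ↔ R x v) : PolyRel enc d S := by
  have : S = R := by
    ext x v
    exact h x v
  rwa [this]

theorem PolyRel.rename {e : ℕ} {R : α → (Fin d → ℕ) → Prop} (hR : PolyRel enc d R)
    (σ : Fin d → Fin e) : PolyRel enc e (fun x v => R x (fun i => v (σ i))) :=
  PolyFn.rename hR σ

theorem PolyFn.cond {R : α → (Fin d → ℕ) → Prop} {f g : α → (Fin d → ℕ) → ℕ}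
    [∀ x v, Decidable (R x v)] (hR : PolyRel enc d R) (hf : PolyFn enc d f)
    (hg : PolyFn enc d g) : PolyFn enc d (fun x v => if R x v then f x v else g x v) := by
  convert PolyFn.ite hR.fn hf hg using 4 with x v
  by_cases h : R x v <;> simp [h]

theorem PolyRel.not {R : α → (Fin d → ℕ) → Prop} (hR : PolyRel enc d R) :
    PolyRel enc d (fun x v => ¬ R x v) := by
  classical
  exact .of_fn (PolyFn.cond hR (.const 0) (.const 1)) fun x v => by
    by_cases h : R x v <;> simp [h]

theorem PolyRel.and {R S : α → (Fin d → ℕ) → Prop} (hR : PolyRel enc d R)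
    (hS : PolyRel enc d S) : PolyRel enc d (fun x v => R x v ∧ S x v) := by
  classical
  exact .of_fn (PolyFn.cond hR hS.fn (.const 0)) fun x v => by
    by_cases h : R x v <;> simp [h]

theorem PolyRel.or {R S : α → (Fin d → ℕ) → Prop} (hR : PolyRel enc d R)
    (hS : PolyRel enc d S) : PolyRel enc d (fun x v => R x v ∨ S x v) := by
  classical
  exact .of_fn (PolyFn.cond hR (.const 1) hS.fn) fun x v => by
    by_cases h : R x v <;> simp [h]

theorem PolyRel.imp {R S : α → (Fin d → ℕ) → Prop} (hR : PolyRel enc d R)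
    (hS : PolyRel enc d S) : PolyRel enc d (fun x v => R x v → S x v) :=
  (hR.not.or hS).congr fun _ _ => imp_iff_not_or

theorem PolyRel.lt {f g : α → (Fin d → ℕ) → ℕ} (hf : PolyFn enc d f) (hg : PolyFn enc d g) :
    PolyRel enc d (fun x v => f x v < g x v) :=
  .of_fn (hg.sub hf) fun x v => by omega

theorem PolyRel.le {f g : α → (Fin d → ℕ) → ℕ} (hf : PolyFn enc d f) (hg : PolyFn enc d g) :
    PolyRel enc d (fun x v => f x v ≤ g x v) :=
  (PolyRel.lt hg hf).not.congr fun _ _ => not_lt.symm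

theorem PolyRel.eq {f g : α → (Fin d → ℕ) → ℕ} (hf : PolyFn enc d f) (hg : PolyFn enc d g) :
    PolyRel enc d (fun x v => f x v = g x v) :=
  ((PolyRel.le hf hg).and (.le hg hf)).congr fun _ _ => le_antisymm_iff

theorem PolyRel.const (p : Prop) : PolyRel enc d (fun _ _ => p) := by
  by_cases h : p
  · exact .of_fn (.const 1) fun _ _ => by simp [h]
  · exact .of_fn (.const 0) fun _ _ => by simp [h]

theorem PolyRel.exists_lt {B : α → (Fin d → ℕ) → ℕ} {R : α → (Fin d → ℕ) → ℕ → Prop}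
    (hB : PolyFn enc d B) (hq : PolyBounded enc B)
    (h : PolyRel enc (d + 1) (fun x v => R x (fun i => v i.succ) (v 0))) :
    PolyRel enc d (fun x v => ∃ a < B x v, R x v a) := by
  classical
  refine .of_fn (.fold hB hq (.const 0) (g := fun x w =>
    if R x (fun i => w i.succ.succ) (w 1) then 1 else w 0)
    (.cond (h.rename Fin.succ) (.const 1) (.var 0))) fun x v => ?_
  generalize B x v = n
  simp only [Fin.cons_succ, Fin.cons_one, Fin.cons_zero]
  induction n with
  | zero => simp
  | succ n ih =>
    by_cases hn : R x v n
    · simp only [hn, if_true, ne_eq, one_ne_zero, not_false_eq_true, iff_true]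
      exact ⟨n, Nat.lt_succ_self n, hn⟩
    · simp only [hn, if_false]
      rw [← ih]
      refine ⟨fun ⟨a, ha, hR⟩ => ⟨a, ?_, hR⟩, fun ⟨a, ha, hR⟩ => ⟨a, ha.trans n.lt_succ_self, hR⟩⟩
      rcases Nat.lt_succ_iff_lt_or_eq.1 ha with ha | rfl
      · exact ha
      · exact absurd hR hn

theorem PolyRel.exists_const {K : ℕ} {R : Fin K → α → (Fin d → ℕ) → Prop}
    (h : ∀ i, PolyRel enc d (R i)) : PolyRel enc d (fun x v => ∃ i, R i x v) := by
  induction K with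
  | zero => exact (PolyRel.const False).congr fun x v => by simp
  | succ K ih =>
    exact ((h 0).or (ih fun i => h i.succ)).congr fun x v => Fin.exists_fin_succ

theorem PolyRel.forall_const {K : ℕ} {R : Fin K → α → (Fin d → ℕ) → Prop}
    (h : ∀ i, PolyRel enc d (R i)) : PolyRel enc d (fun x v => ∀ i, R i x v) :=
  (PolyRel.exists_const fun i => (h i).not).not.congr fun x v => by simp

/-! ### Arithmetic -/

theorem PolyBounded.mono {f g : α → (Fin d → ℕ) → ℕ} (hg : PolyBounded enc g)
    (h : ∀ x v, f x v ≤ g x v) : PolyBounded enc f :=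
  let ⟨q, hq⟩ := hg
  ⟨q, fun x v => (h x v).trans (hq x v)⟩

theorem PolyBounded.const (c : ℕ) : PolyBounded enc (d := d) (fun _ _ => c) :=
  ⟨Polynomial.C c, fun _ _ => by simp⟩

theorem PolyBounded.length : PolyBounded enc (d := d) (fun x _ => (enc x).length) :=
  ⟨Polynomial.X, fun _ _ => by simp⟩

theorem PolyFn.mul {f g : α → (Fin d → ℕ) → ℕ} (hf : PolyFn enc d f) (hb : PolyBounded enc f)
    (hg : PolyFn enc d g) : PolyFn enc d (fun x v => f x v * g x v) := by
  convert PolyFn.fold hf hb (.const 0) (g := fun x w => w 0 + g x (fun i => w i.succ.succ))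
    ((PolyFn.var 0).add (hg.rename fun i => i.succ.succ)) using 3 with x v
  generalize f x v = n
  induction n with
  | zero => simp
  | succ n ih =>
    rw [Nat.succ_mul, ih]
    rfl

theorem PolyFn.div {f g : α → (Fin d → ℕ) → ℕ} (hf : PolyFn enc d f) (hfb : PolyBounded enc f)
    (hg : PolyFn enc d g) (hgb : PolyBounded enc g) (hpos : ∀ x v, 0 < g x v) :
    PolyFn enc d (fun x v => f x v / g x v) := by
  convert PolyFn.fold hf hfb (.const 0) (g := fun x w =>
    if g x (fun i => w i.succ.succ) * (w 0 + 1) ≤ f x (fun i => w i.succ.succ) then w 0 + 1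
      else w 0)
    (.cond (.le ((hg.rename fun i => i.succ.succ).mul
      (hgb.imp fun q h x w => h x (fun i => w i.succ.succ)) ((PolyFn.var 0).add (.const 1)))
      (hf.rename fun i => i.succ.succ)) ((PolyFn.var 0).add (.const 1)) (.var 0))
    using 3 with x v
  have key : ∀ n, min n (f x v / g x v) = Nat.rec (motive := fun _ => ℕ) 0
      (fun _ acc => if g x v * (acc + 1) ≤ f x v then acc + 1 else acc) n := by
    intro n
    induction n with
    | zero => simp
    | succ n ih =>
      simp only [← ih]
      have h := Nat.le_div_iff_mul_le (x := min n (f x v / g x v) + 1) (y := f x v) (hpos x v)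
      rw [mul_comm] at h
      split_ifs with hc
      · have := h.2 hc
        omega
      · have := fun h' => hc (h.1 h')
        omega
  have := key (f x v)
  rwa [min_eq_right (Nat.div_le_self _ _)] at this

theorem PolyFn.mod {f g : α → (Fin d → ℕ) → ℕ} (hf : PolyFn enc d f) (hfb : PolyBounded enc f)
    (hg : PolyFn enc d g) (hgb : PolyBounded enc g) (hpos : ∀ x v, 0 < g x v) :
    PolyFn enc d (fun x v => f x v % g x v) := by
  convert hf.sub (hg.mul hgb (hf.div hfb hg hgb hpos)) using 3 with x v
  exact Nat.mod_eq_sub_mul_div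

/-! ### Numbers below a polynomial bound -/

variable (enc) in
/-- The number `B x` is positive, polynomial in the length of `x`, and computed in polynomial
time. -/
structure PolySize (B : α → ℕ) : Prop where
  fn (d : ℕ) : PolyFn enc d (fun x _ => B x)
  bounded : ∃ q : Polynomial ℕ, ∀ x, B x ≤ q.eval (enc x).length
  pos (x : α) : 0 < B x

theorem PolySize.polyBounded {B : α → ℕ} (hB : PolySize enc B) :
    PolyBounded enc (d := d) (fun x _ => B x) :=
  hB.bounded.imp fun _ h x _ => h x

theorem PolySize.polyBounded_val {B : α → ℕ} (hB : PolySize enc B)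
    (f : ∀ x, (Fin d → ℕ) → Fin (B x)) : PolyBounded enc (fun x v => (f x v : ℕ)) :=
  hB.polyBounded.mono fun x v => (f x v).2.le

theorem PolySize.const {c : ℕ} (hc : 0 < c) : PolySize enc (fun _ => c) :=
  ⟨fun _ => .const c, ⟨Polynomial.C c, fun _ => by simp⟩, fun _ => hc⟩

theorem PolySize.mul {A B : α → ℕ} (hA : PolySize enc A) (hB : PolySize enc B) :
    PolySize enc (fun x => A x * B x) where
  fn d := (hA.fn d).mul hA.polyBounded (hB.fn d)
  bounded := by
    obtain ⟨p, hp⟩ := hA.bounded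
    obtain ⟨q, hq⟩ := hB.bounded
    refine ⟨p * q, fun x => ?_⟩
    rw [Polynomial.eval_mul]
    exact Nat.mul_le_mul (hp x) (hq x)
  pos x := Nat.mul_pos (hA.pos x) (hB.pos x)

theorem PolySize.pow {B : α → ℕ} (hB : PolySize enc B) (K : ℕ) :
    PolySize enc (fun x => B x ^ K) := by
  induction K with
  | zero => exact .const Nat.one_pos
  | succ K ih => exact ih.mul hB

/-- The number `a`, or `0` if `a` is not below `B`. -/
def clamp {B : ℕ} (hB : 0 < B) (a : ℕ) : Fin B :=
  if h : a < B then ⟨a, h⟩ else ⟨0, hB⟩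

theorem clamp_val {B : ℕ} (hB : 0 < B) (a : Fin B) : clamp hB a = a := by
  simp [clamp]

theorem PolySize.clamp {B : α → ℕ} (hB : PolySize enc B) {f : α → (Fin d → ℕ) → ℕ}
    (hf : PolyFn enc d f) : PolyFn enc d (fun x v => (clamp (hB.pos x) (f x v) : ℕ)) := by
  convert PolyFn.cond (.lt hf (hB.fn d)) hf (.const 0) using 3 with x v
  unfold RAM.clamp
  split_ifs <;> rfl

theorem PolyRel.exists_fin {B : α → ℕ} (hB : PolySize enc B)
    {R : ∀ x, (Fin d → ℕ) → Fin (B x) → Prop}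
    (h : PolyRel enc (d + 1) (fun x v => R x (fun i => v i.succ) (clamp (hB.pos x) (v 0)))) :
    PolyRel enc d (fun x v => ∃ a, R x v a) := by
  refine (PolyRel.exists_lt (R := fun x v a => R x v (RAM.clamp (hB.pos x) a)) (hB.fn d)
    hB.polyBounded h).congr fun x v => ⟨fun ⟨a, ha⟩ => ?_,
    fun ⟨a, _, ha⟩ => ⟨_, ha⟩⟩
  refine ⟨a, a.2, ?_⟩
  rwa [clamp_val]

theorem PolyRel.eq_fin {B : α → ℕ} {f g : ∀ x, (Fin d → ℕ) → Fin (B x)}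
    (hf : PolyFn enc d (fun x v => (f x v : ℕ))) (hg : PolyFn enc d (fun x v => (g x v : ℕ))) :
    PolyRel enc d (fun x v => f x v = g x v) :=
  (PolyRel.eq hf hg).congr fun _ _ => Fin.ext_iff

open Relation in
theorem PolyRel.reach_fin {B : α → ℕ} (hB : PolySize enc B)
    {s t : ∀ x, (Fin d → ℕ) → Fin (B x)} {E : ∀ x, (Fin d → ℕ) → Fin (B x) → Fin (B x) → Prop}
    (hs : PolyFn enc d (fun x v => (s x v : ℕ))) (ht : PolyFn enc d (fun x v => (t x v : ℕ)))
    (hE : PolyRel enc (d + 2) (fun x v => E x (fun i => v i.succ.succ)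
      (RAM.clamp (hB.pos x) (v 0)) (RAM.clamp (hB.pos x) (v 1)))) :
    PolyRel enc d (fun x v => ReflTransGen (E x v) (s x v) (t x v)) := by
  refine (PolyRel.reach (hB.fn d) hB.polyBounded hs ht hE (fun x v => (s x v).2)
    (fun x v => (t x v).2)).congr fun x v => ⟨fun h => ?_, fun h => ?_⟩
  · refine h.lift (fun a : Fin (B x) => (a : ℕ)) fun a c hac => ⟨a.2, c.2, ?_⟩
    simpa [clamp_val] using hac
  · have := h.lift (RAM.clamp (hB.pos x)) (p := E x v) fun a c hac => by simpa using hac.2.2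
    simpa [Function.onFun, clamp_val] using this

end RAM

/-! ## Reading the encoding of a history -/

theorem List.drop_flatten_of_forall_length {β : Type*} {c : ℕ} (L : List (List β))
    (h : ∀ l ∈ L, l.length = c) (i : ℕ) : L.flatten.drop (i * c) = (L.drop i).flatten := by
  induction L generalizing i with
  | nil => simp
  | cons l L ih =>
    cases i with
    | zero => simp
    | succ i =>
      have hl : l.length = c := h l (by simp)
      have : (i + 1) * c = l.length + i * c := by rw [hl]; ring
      rw [List.flatten_cons, this, List.drop_append, List.drop_eq_nil_of_le (by omega)]
      simp [ih (fun l hl => h l (by simp [hl]))]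

theorem List.getD_add {β : Type*} (l : List β) (i j : ℕ) (a : β) :
    l.getD (i + j) a = (l.drop i).getD j a := by
  simp [List.getD_eq_getElem?_getD, List.getElem?_drop]

namespace FiniteHistory

variable (H : FiniteHistory)

/-- The part of the encoding that describes the transaction `t`. -/
def block (t : Fin H.n) : List ℕ :=
  (H.hist.txn t).length ::
    ((H.hist.txn t).mapIdx fun i o => o.encode (H.hist.src t i : ℕ)).flatten

open Classical in
/-- The row of `t` in the matrix of the session order. -/
noncomputable def soRow (a : Fin H.n) : List ℕ :=
  (List.finRange H.n).map fun b => if H.hist.so a b then 1 else 0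

theorem encode_eq : H.encode = [H.n, (H.hist.init : ℕ)] ++
    ((List.finRange H.n).map H.soRow).flatten ++ ((List.finRange H.n).map H.block).flatten := rfl

theorem n_pos : 0 < H.n := Fin.pos H.hist.init

theorem length_soRow (a : Fin H.n) : (H.soRow a).length = H.n := by
  simp [soRow]

theorem length_soRows : ((List.finRange H.n).map H.soRow).flatten.length = H.n * H.n := by
  rw [List.length_flatten, List.map_map]
  have : (List.length ∘ H.soRow) = fun _ => H.n := funext H.length_soRow
  simp [this]

theorem length_encode_op (s : ℕ) (o : TxOp) : (o.encode s).length = 4 := by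
  cases o <;> rfl

theorem length_ops (t : Fin H.n) :
    ((H.hist.txn t).mapIdx fun i o => o.encode (H.hist.src t i : ℕ)).flatten.length =
      (H.hist.txn t).length * 4 := by
  rw [List.length_flatten, List.sum_eq_card_nsmul _ 4]
  · simp
  · intro n hn
    obtain ⟨l, hl, rfl⟩ := List.mem_map.1 hn
    obtain ⟨i, hi, rfl⟩ := List.mem_mapIdx.1 hl
    exact length_encode_op _ _

theorem n_le_length : H.n ≤ H.encode.length := by
  rw [encode_eq]
  simp only [List.length_append, length_soRows]
  nlinarith [H.n_pos]

open Classical in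
theorem getD_so (a b : Fin H.n) :
    H.encode.getD (2 + a * H.n + b) 0 = if H.hist.so a b then 1 else 0 := by
  rw [encode_eq, List.append_assoc, add_assoc, List.getD_add]
  simp only [List.cons_append, List.nil_append, List.drop_succ_cons, List.drop_zero]
  have hlt : (a : ℕ) * H.n + b < ((List.finRange H.n).map H.soRow).flatten.length := by
    rw [length_soRows]
    have := Nat.mul_le_mul_right H.n (Nat.succ_le_of_lt a.2)
    have := b.2
    rw [Nat.succ_mul] at *
    omega
  rw [List.getD_append _ _ _ _ hlt, List.getD_add, List.drop_flatten_of_forall_length]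
  · rw [List.drop_eq_getElem_cons (by simp), List.flatten_cons,
      List.getD_append _ _ _ _ (by simp [length_soRow])]
    simp [soRow]
  · intro l hl
    obtain ⟨a, -, rfl⟩ := List.mem_map.1 hl
    exact H.length_soRow a

/-- The address of the first cell of the description of the transaction with number `t`. -/
noncomputable def offset (t : ℕ) : ℕ :=
  Nat.rec (motive := fun _ => ℕ) (2 + H.n * H.n)
    (fun _ acc => acc + 1 + H.encode.getD acc 0 * 4) t

theorem drop_offset (t : ℕ) (ht : t ≤ H.n) :
    H.encode.drop (H.offset t) = (((List.finRange H.n).drop t).map H.block).flatten := by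
  induction t with
  | zero =>
    change H.encode.drop (2 + H.n * H.n) = _
    rw [encode_eq, List.drop_append, List.drop_eq_nil_of_le (by
      rw [List.length_append, length_soRows]
      exact le_rfl)]
    simp only [List.length_append, length_soRows, List.length_cons, List.length_nil]
    simp
  | succ t ih =>
    have ih := ih (by omega)
    rw [List.drop_eq_getElem_cons (l := List.finRange H.n) (by simpa using ht)] at ih
    simp only [List.getElem_finRange, List.map_cons, List.flatten_cons, Fin.cast_mk] at ih
    have h0 : H.encode.getD (H.offset t) 0 = (H.hist.txn ⟨t, ht⟩).length := by
      have := H.encode.getD_add (H.offset t) 0 0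
      rw [ih] at this
      exact this
    have h1 : H.offset (t + 1) = H.offset t + (H.block ⟨t, ht⟩).length := by
      change H.offset t + 1 + H.encode.getD (H.offset t) 0 * 4 = _
      rw [h0, block, List.length_cons, length_ops]
      ring
    rw [h1, ← List.drop_drop, ih, List.drop_append, List.drop_eq_nil_of_le le_rfl]
    simp

theorem drop_offset_eq (t : Fin H.n) : ∃ l, H.encode.drop (H.offset t) = H.block t ++ l := by
  rw [drop_offset _ _ t.2.le, List.drop_eq_getElem_cons (by simp)]
  exact ⟨_, by simp [List.getElem_finRange]; rfl⟩

theorem getD_offset (t : Fin H.n) : H.encode.getD (H.offset t) 0 = (H.hist.txn t).length := by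
  obtain ⟨l, hl⟩ := H.drop_offset_eq t
  have := H.encode.getD_add (H.offset t) 0 0
  rw [hl] at this
  exact this

theorem length_txn_le (t : Fin H.n) : (H.hist.txn t).length ≤ H.encode.length := by
  obtain ⟨l, hl⟩ := H.drop_offset_eq t
  have h := congrArg List.length hl
  rw [List.length_append, block, List.length_cons, length_ops, List.length_drop] at h
  omega

theorem getD_op (t : Fin H.n) (i c : ℕ) (o : TxOp) (h : (H.hist.txn t)[i]? = some o) (hc : c < 4) :
    H.encode.getD (H.offset t + 1 + i * 4 + c) 0 = (o.encode (H.hist.src t i : ℕ)).getD c 0 := by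
  obtain ⟨l, hl⟩ := H.drop_offset_eq t
  obtain ⟨hi, ho⟩ := List.getElem?_eq_some_iff.1 h
  rw [add_assoc, add_assoc, List.getD_add, hl, block]
  rw [List.getD_append _ _ _ _ (by rw [List.length_cons, length_ops]; omega), List.getD_add,
    List.drop_succ_cons, List.drop_zero, List.getD_add, List.drop_flatten_of_forall_length]
  · rw [List.drop_eq_getElem_cons (by simpa using hi), List.flatten_cons,
      List.getD_append _ _ _ _ (by simpa [length_encode_op] using hc)]
    simp [ho]
  · intro l hl
    obtain ⟨i, hi, rfl⟩ := List.mem_mapIdx.1 hl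
    exact length_encode_op _ _

theorem read_iff (t : Fin H.n) {i : ℕ} (hi : i < (H.hist.txn t).length) (x : ℕ) :
    (∃ v, (H.hist.txn t)[i]? = some (.read x v)) ↔
      H.encode.getD (H.offset t + 1 + i * 4 + 0) 0 = 0 ∧
        H.encode.getD (H.offset t + 1 + i * 4 + 1) 0 = x := by
  have h := List.getElem?_eq_getElem hi
  rw [H.getD_op t i 0 _ h (by norm_num), H.getD_op t i 1 _ h (by norm_num), h]
  cases (H.hist.txn t)[i] <;> simp [TxOp.encode]

theorem write_iff (t : Fin H.n) {i : ℕ} (hi : i < (H.hist.txn t).length) (x : ℕ) :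
    (∃ v, (H.hist.txn t)[i]? = some (.write x v)) ↔
      H.encode.getD (H.offset t + 1 + i * 4 + 0) 0 = 1 ∧
        H.encode.getD (H.offset t + 1 + i * 4 + 1) 0 = x := by
  have h := List.getElem?_eq_getElem hi
  rw [H.getD_op t i 0 _ h (by norm_num), H.getD_op t i 1 _ h (by norm_num), h]
  cases (H.hist.txn t)[i] <;> simp [TxOp.encode]

theorem src_eq_iff (a t : Fin H.n) {i : ℕ} (hi : i < (H.hist.txn t).length)
    (h0 : H.encode.getD (H.offset t + 1 + i * 4 + 0) 0 = 0) :
    H.hist.src t i = a ↔ H.encode.getD (H.offset t + 1 + i * 4 + 3) 0 = a := by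
  have h := List.getElem?_eq_getElem hi
  rw [H.getD_op t i 0 _ h (by norm_num)] at h0
  rw [H.getD_op t i 3 _ h (by norm_num), Fin.ext_iff]
  generalize (H.hist.txn t)[i] = o at *
  cases o <;> simp_all [TxOp.encode]

theorem writes_iff (t : Fin H.n) (x : ℕ) : H.hist.Writes t x ↔ ∃ i < H.encode.length,
    i < H.encode.getD (H.offset t) 0 ∧ H.encode.getD (H.offset t + 1 + i * 4 + 0) 0 = 1 ∧
      H.encode.getD (H.offset t + 1 + i * 4 + 1) 0 = x := by
  rw [getD_offset]
  constructor
  · rintro ⟨v, hv⟩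
    obtain ⟨i, hi⟩ := List.mem_iff_getElem?.1 hv
    have hlt : i < (H.hist.txn t).length := (List.getElem?_eq_some_iff.1 hi).1
    exact ⟨i, hlt.trans_le (H.length_txn_le t), hlt, (H.write_iff t hlt x).1 ⟨v, hi⟩⟩
  · rintro ⟨i, -, hi, h⟩
    obtain ⟨v, hv⟩ := (H.write_iff t hi x).2 h
    exact ⟨v, List.mem_iff_getElem?.2 ⟨i, hv⟩⟩

theorem wrOn_iff (a t : Fin H.n) (x : ℕ) : H.hist.wrOn x a t ↔ ∃ i < H.encode.length,
    i < H.encode.getD (H.offset t) 0 ∧ (H.encode.getD (H.offset t + 1 + i * 4 + 0) 0 = 0 ∧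
      H.encode.getD (H.offset t + 1 + i * 4 + 3) 0 = a) ∧
      H.encode.getD (H.offset t + 1 + i * 4 + 1) 0 = x := by
  rw [getD_offset]
  constructor
  · rintro ⟨i, v, hv, ha⟩
    have hlt : i < (H.hist.txn t).length := (List.getElem?_eq_some_iff.1 hv).1
    obtain ⟨h0, h1⟩ := (H.read_iff t hlt x).1 ⟨v, hv⟩
    exact ⟨i, hlt.trans_le (H.length_txn_le t), hlt, ⟨h0, (H.src_eq_iff a t hlt h0).1 ha⟩, h1⟩
  · rintro ⟨i, -, hi, ⟨h0, h3⟩, h1⟩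
    obtain ⟨v, hv⟩ := (H.read_iff t hi x).2 ⟨h0, h1⟩
    exact ⟨i, v, hv, (H.src_eq_iff a t hi h0).2 h3⟩

end FiniteHistory

namespace RAM

variable {d : ℕ}

theorem polySize_n : PolySize FiniteHistory.encode FiniteHistory.n where
  fn d := PolyFn.cell (.const 0)
  bounded := ⟨Polynomial.X, fun H => by simpa using H.n_le_length⟩
  pos H := H.n_pos

theorem polyFn_init : PolyFn FiniteHistory.encode d (fun H _ => (H.hist.init : ℕ)) :=
  PolyFn.cell (.const 1)

/-- A transaction of the history that is computed in polynomial time. -/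
abbrev PolyTxn (d : ℕ) (f : ∀ H : FiniteHistory, (Fin d → ℕ) → Fin H.n) : Prop :=
  PolyFn FiniteHistory.encode d (fun H v => (f H v : ℕ))

variable {f g k : ∀ H : FiniteHistory, (Fin d → ℕ) → Fin H.n}

theorem PolyTxn.so (hf : PolyTxn d f) (hg : PolyTxn d g) :
    PolyRel FiniteHistory.encode d (fun H v => H.hist.so (f H v) (g H v)) := by
  refine .of_fn (((PolyFn.const 2).add (hf.mul (polySize_n.polyBounded_val f)
    (polySize_n.fn d))).add hg).cell fun H v => ?_
  rw [H.getD_so]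
  simp

theorem PolyTxn.offset (hf : PolyTxn d f) :
    PolyFn FiniteHistory.encode d (fun H v => H.offset (f H v)) := by
  have h : PolyFn FiniteHistory.encode (d + 2) (fun H w => H.encode.getD (w 0) 0 * 4) := by
    simpa only [mul_comm] using (PolyFn.const 4).mul (.const 4) (PolyFn.var 0).cell
  exact .fold hf (polySize_n.polyBounded_val f) (z := fun H _ => 2 + H.n * H.n)
    ((PolyFn.const 2).add ((polySize_n.fn d).mul polySize_n.polyBounded (polySize_n.fn d)))
    (((PolyFn.var 0).add (.const 1)).add h)

theorem PolyTxn.opCell (hf : PolyTxn d f) {i : FiniteHistory → (Fin d → ℕ) → ℕ}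
    (hi : PolyFn FiniteHistory.encode d i) (c : ℕ) :
    PolyFn FiniteHistory.encode d
      (fun H v => H.encode.getD (H.offset (f H v) + 1 + i H v * 4 + c) 0) :=
  (((hf.offset.add (.const 1)).add (by
    simpa only [mul_comm] using (PolyFn.const 4).mul (.const 4) hi)).add (.const c)).cell

theorem PolyTxn.weaken (hf : PolyTxn d f) : PolyTxn (d + 1) (fun H v => f H (fun i => v i.succ)) :=
  hf.rename Fin.succ

theorem PolyTxn.wr (hf : PolyTxn d f) (hg : PolyTxn d g) :
    PolyRel FiniteHistory.encode d (fun H v => H.hist.wr (f H v) (g H v)) := by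
  refine (PolyRel.exists_lt .length .length (R := fun H v i =>
    i < H.encode.getD (H.offset (g H v)) 0 ∧
      H.encode.getD (H.offset (g H v) + 1 + i * 4 + 0) 0 = 0 ∧
      H.encode.getD (H.offset (g H v) + 1 + i * 4 + 3) 0 = f H v)
    ((PolyRel.lt (.var 0) hg.weaken.offset.cell).and
      ((PolyRel.eq (hg.weaken.opCell (.var 0) 0) (.const 0)).and
        (.eq (hg.weaken.opCell (.var 0) 3) hf.weaken)))).congr fun H v => ?_
  simp only [History.wr, H.wrOn_iff]
  tauto

theorem PolyTxn.wrOn_writes (hf : PolyTxn d f) (hg : PolyTxn d g) (hk : PolyTxn d k) :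
    PolyRel FiniteHistory.encode d
      (fun H v => ∃ x, H.hist.wrOn x (f H v) (g H v) ∧ H.hist.Writes (k H v) x) := by
  refine (PolyRel.exists_lt .length .length (R := fun H v i => ∃ j < H.encode.length,
    (i < H.encode.getD (H.offset (g H v)) 0 ∧
      H.encode.getD (H.offset (g H v) + 1 + i * 4 + 0) 0 = 0 ∧
      H.encode.getD (H.offset (g H v) + 1 + i * 4 + 3) 0 = f H v) ∧
    (j < H.encode.getD (H.offset (k H v)) 0 ∧
      H.encode.getD (H.offset (k H v) + 1 + j * 4 + 0) 0 = 1) ∧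
      H.encode.getD (H.offset (k H v) + 1 + j * 4 + 1) 0 =
        H.encode.getD (H.offset (g H v) + 1 + i * 4 + 1) 0)
    (.exists_lt (R := fun (H : FiniteHistory) w j =>
      (w 0 < H.encode.getD (H.offset (g H fun i => w i.succ)) 0 ∧
        H.encode.getD (H.offset (g H fun i => w i.succ) + 1 + w 0 * 4 + 0) 0 = 0 ∧
        H.encode.getD (H.offset (g H fun i => w i.succ) + 1 + w 0 * 4 + 3) 0 =
          f H fun i => w i.succ) ∧
      (j < H.encode.getD (H.offset (k H fun i => w i.succ)) 0 ∧
        H.encode.getD (H.offset (k H fun i => w i.succ) + 1 + j * 4 + 0) 0 = 1) ∧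
        H.encode.getD (H.offset (k H fun i => w i.succ) + 1 + j * 4 + 1) 0 =
          H.encode.getD (H.offset (g H fun i => w i.succ) + 1 + w 0 * 4 + 1) 0)
      .length .length (((PolyRel.lt (.var 1) hg.weaken.weaken.offset.cell).and
      ((PolyRel.eq (hg.weaken.weaken.opCell (.var 1) 0) (.const 0)).and
        (.eq (hg.weaken.weaken.opCell (.var 1) 3) hf.weaken.weaken))).and
      (((PolyRel.lt (.var 0) hk.weaken.weaken.offset.cell).and
      (PolyRel.eq (hk.weaken.weaken.opCell (.var 0) 0) (.const 1))).and
      (.eq (hk.weaken.weaken.opCell (.var 0) 1) (hg.weaken.weaken.opCell (.var 1) 1)))))).congr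
    fun H v => ?_
  simp only [H.wrOn_iff, H.writes_iff]
  constructor
  · rintro ⟨x, ⟨i, hi, h1, h2, rfl⟩, ⟨j, hj, h4, h5, h6⟩⟩
    exact ⟨i, hi, j, hj, ⟨h1, h2⟩, ⟨h4, h5⟩, h6⟩
  · rintro ⟨i, hi, j, hj, ⟨h1, h2⟩, ⟨h4, h5⟩, h6⟩
    exact ⟨_, ⟨i, hi, h1, h2, rfl⟩, ⟨j, hj, h4, h5, h6⟩⟩

theorem PolyTxn.writes_writes (hg : PolyTxn d g) (hk : PolyTxn d k) :
    PolyRel FiniteHistory.encode d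
      (fun H v => ∃ x, H.hist.Writes (g H v) x ∧ H.hist.Writes (k H v) x) := by
  refine (PolyRel.exists_lt .length .length (R := fun H v i => ∃ j < H.encode.length,
    (i < H.encode.getD (H.offset (g H v)) 0 ∧
      H.encode.getD (H.offset (g H v) + 1 + i * 4 + 0) 0 = 1) ∧
    (j < H.encode.getD (H.offset (k H v)) 0 ∧
      H.encode.getD (H.offset (k H v) + 1 + j * 4 + 0) 0 = 1) ∧
      H.encode.getD (H.offset (k H v) + 1 + j * 4 + 1) 0 =
        H.encode.getD (H.offset (g H v) + 1 + i * 4 + 1) 0)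
    (.exists_lt (R := fun (H : FiniteHistory) w j =>
      (w 0 < H.encode.getD (H.offset (g H fun i => w i.succ)) 0 ∧
        H.encode.getD (H.offset (g H fun i => w i.succ) + 1 + w 0 * 4 + 0) 0 = 1) ∧
      (j < H.encode.getD (H.offset (k H fun i => w i.succ)) 0 ∧
        H.encode.getD (H.offset (k H fun i => w i.succ) + 1 + j * 4 + 0) 0 = 1) ∧
        H.encode.getD (H.offset (k H fun i => w i.succ) + 1 + j * 4 + 1) 0 =
          H.encode.getD (H.offset (g H fun i => w i.succ) + 1 + w 0 * 4 + 1) 0)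
      .length .length (((PolyRel.lt (.var 1) hg.weaken.weaken.offset.cell).and
      (PolyRel.eq (hg.weaken.weaken.opCell (.var 1) 0) (.const 1))).and
      (((PolyRel.lt (.var 0) hk.weaken.weaken.offset.cell).and
      (PolyRel.eq (hk.weaken.weaken.opCell (.var 0) 0) (.const 1))).and
      (.eq (hk.weaken.weaken.opCell (.var 0) 1) (hg.weaken.weaken.opCell (.var 1) 1)))))).congr
    fun H v => ?_
  simp only [H.writes_iff]
  constructor
  · rintro ⟨x, ⟨i, hi, h1, h2, rfl⟩, ⟨j, hj, h4, h5, h6⟩⟩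
    exact ⟨i, hi, j, hj, ⟨h1, h2⟩, ⟨h4, h5⟩, h6⟩
  · rintro ⟨i, hi, j, hj, ⟨h1, h2⟩, ⟨h4, h5⟩, h6⟩
    exact ⟨_, ⟨i, hi, h1, h2, rfl⟩, ⟨j, hj, h4, h5, h6⟩⟩

end RAM

/-! ## Splitting transactions into a read part and a write part -/

namespace History

variable {T : Type} (h : History T)

theorem wr_ne {a b : T} (hab : h.wr a b) : a ≠ b := by
  rintro rfl
  obtain ⟨x, i, v, hi, ha⟩ := hab
  exact h.acyclic a (.single (.inr ⟨i, x, v, hi, ha⟩))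

theorem so_wr_acyclic (t : T) : ¬ Relation.TransGen (fun a b => h.so a b ∨ h.wr a b) t t := by
  refine fun ht => h.acyclic t (Relation.TransGen.mono (fun a b hab => hab.imp_right ?_) _ _ ht)
  rintro ⟨x, i, v, hi⟩
  exact ⟨i, x, v, hi⟩

theorem not_so_init (t : T) : ¬ h.so t h.init := fun ht => by
  by_cases he : t = h.init
  · exact h.so_irrefl _ (he ▸ ht)
  · exact h.so_irrefl _ (h.so_trans _ _ _ ht (h.init_first t he))

theorem not_wr_init (t : T) : ¬ h.wr t h.init := fun ht =>
  h.so_wr_acyclic t ((Relation.TransGen.single (.inr ht)).tail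
    (.inl (h.init_first t (h.wr_ne ht))))

/-- The events of a history: `(0, t)` is the read part of the transaction `t`, which takes its
snapshot, and `(1, t)` is its write part, which commits it. -/
abbrev Event (T : Type) := Fin 2 × T

/-- The order of the events that every criterion demands. -/
def EvLt (a b : Event T) : Prop := (a.2 = b.2 ∧ a.1 < b.1) ∨ h.so a.2 b.2 ∨ h.wr a.2 b.2

/-- The write `b` may not come between the write `a` and the part `r` of a transaction that reads
from `a`. -/
def ReadForbids (r : Fin 2) (a b c : Event T) : Prop :=
  (a.1 = 1 ∧ b.1 = 1 ∧ c.1 = r) ∧ a.2 ≠ b.2 ∧ ∃ x, h.wrOn x a.2 c.2 ∧ h.Writes b.2 x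

/-- The conflicting write `b` may not come between the parts `a` and `c` of a transaction. -/
def ConflictForbids (a b c : Event T) : Prop :=
  (a.1 = 0 ∧ b.1 = 1 ∧ c.1 = 1) ∧ a.2 = c.2 ∧ b.2 ≠ c.2 ∧ ∃ x, h.Writes b.2 x ∧ h.Writes c.2 x

/-- The event `b` may not come between the events `a` and `c`. -/
def Forbids (X : Criterion) (a b c : Event T) : Prop :=
  match X with
  | .PC => h.ReadForbids 0 a b c
  | .SI => h.ReadForbids 0 a b c ∨ h.ConflictForbids a b c
  | .SER => h.ReadForbids 1 a b c

/-- The events of the transactions in `Z` can be ordered according to the criterion. -/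
def Orderable (X : Criterion) (Z : Set T) : Prop :=
  ∃ lt : Event T → Event T → Prop, (∀ a, ¬ lt a a) ∧ (∀ a b c, lt a b → lt b c → lt a c) ∧
    (∀ a b, a.2 ∈ Z → b.2 ∈ Z → a ≠ b → lt a b ∨ lt b a) ∧
    (∀ a b, a.2 ∈ Z → b.2 ∈ Z → h.EvLt a b → lt a b) ∧
    ∀ a b c, a.2 ∈ Z → b.2 ∈ Z → c.2 ∈ Z → h.Forbids X a b c → ¬ (lt a b ∧ lt b c)

variable {h}

theorem Orderable.mono {X : Criterion} {Y Z : Set T} (hZ : h.Orderable X Z) (hYZ : Y ⊆ Z) :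
    h.Orderable X Y := by
  obtain ⟨lt, h1, h2, h3, h4, h5⟩ := hZ
  exact ⟨lt, h1, h2, fun a b ha hb => h3 a b (hYZ ha) (hYZ hb),
    fun a b ha hb => h4 a b (hYZ ha) (hYZ hb),
    fun a b c ha hb hc => h5 a b c (hYZ ha) (hYZ hb) (hYZ hc)⟩

theorem Orderable.satisfies {X : Criterion} (hX : h.Orderable X Set.univ) : h.Satisfies X := by
  obtain ⟨lt, h1, h2, h3, h4, h5⟩ := hX
  have h3' : ∀ a b, a ≠ b → lt a b ∨ lt b a := fun a b => h3 a b trivial trivial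
  have h4' : ∀ a b, h.EvLt a b → lt a b := fun a b => h4 a b trivial trivial
  have h5' : ∀ a b c, h.Forbids X a b c → ¬ (lt a b ∧ lt b c) :=
    fun a b c => h5 a b c trivial trivial trivial
  have hco : ∀ a b, Relation.ReflTransGen (fun a b : T => lt (1, a) (1, b)) a b →
      a = b ∨ lt (1, a) (1, b) := fun a b hab => by
    induction hab with
    | refl => exact .inl rfl
    | tail _ hbc ih => exact .inr (ih.elim (fun e => e ▸ hbc) fun h => h2 _ _ _ h hbc)
  have htot : ∀ a b : T, a ≠ b → ¬ lt (1, b) (1, a) → lt (1, a) (1, b) := fun a b hab hn =>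
    (h3' (1, a) (1, b) (by simpa using hab)).resolve_right hn
  have hpre : ∀ (x : ℕ) (t₁ t₂ t₃ t₄ : T), (∀ a b c, h.ReadForbids 0 a b c → h.Forbids X a b c) →
      t₁ ≠ t₂ → h.wrOn x t₁ t₃ → h.Writes t₂ x →
      Relation.ReflTransGen (fun a b : T => lt (1, a) (1, b)) t₂ t₄ → lt (1, t₄) (0, t₃) →
      lt (1, t₂) (1, t₁) := fun x t₁ t₂ t₃ t₄ hR hne hwr hw h24 h43 => by
    refine htot _ _ hne.symm fun h12 => h5' (1, t₁) (1, t₂) (0, t₃)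
      (hR _ _ _ ⟨⟨rfl, rfl, rfl⟩, hne, x, hwr, hw⟩) ⟨h12, ?_⟩
    rcases hco _ _ h24 with rfl | h24
    · exact h43
    · exact h2 _ _ _ h24 h43
  have hprefix : (∀ a b c, h.ReadForbids 0 a b c → h.Forbids X a b c) →
      h.PrefixAxiom (fun a b : T => lt (1, a) (1, b)) := by
    rintro hR x t₁ t₂ t₃ hne hwr hw ⟨t₄, h24, h43⟩
    exact hpre x t₁ t₂ t₃ t₄ hR hne hwr hw h24 (h4' _ _ (.inr h43.symm))
  refine ⟨fun a b => lt (1, a) (1, b), fun t => h1 _, fun a b c => h2 _ _ _, fun a b hab =>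
    h3' _ _ (by simpa using hab), fun a b hab => h4' _ _ (.inr hab.symm), ?_⟩
  cases X with
  | PC => exact hprefix fun _ _ _ => id
  | SI =>
    refine ⟨hprefix fun _ _ _ => .inl, ?_⟩
    intro x y t₁ t₂ t₃ t₄ hne hwr hw h3y h4y h24 h43
    refine hpre x t₁ t₂ t₃ t₄ (fun _ _ _ => .inl) hne hwr hw h24 ?_
    refine (h3' (1, t₄) (0, t₃) (by simp)).resolve_right fun h34 =>
      h5' (0, t₃) (1, t₄) (1, t₃) (.inr ⟨⟨rfl, rfl, rfl⟩, rfl, ?_, y, h4y, h3y⟩) ⟨h34, h43⟩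
    rintro rfl
    exact h1 _ h43
  | SER =>
    intro x t₁ t₂ t₃ hne hwr hw h23
    exact htot _ _ hne.symm fun h12 => h5' (1, t₁) (1, t₂) (1, t₃)
      ⟨⟨rfl, rfl, rfl⟩, hne, x, hwr, hw⟩ ⟨h12, h23⟩

/-- The transactions that have to commit before `t` takes its snapshot, for the commit order
`co`. -/
def Before (h : History T) (X : Criterion) (co : T → T → Prop) (a t : T) : Prop :=
  h.wr a t ∨ h.so a t ∨ match X with
    | .PC => False
    | .SI => co a t ∧ ∃ x, h.Writes a x ∧ h.Writes t x
    | .SER => co a t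

theorem Satisfies.orderable {X : Criterion} (hX : h.Satisfies X) :
    h.Orderable X Set.univ := by
  obtain ⟨co, irr, tr, tot, ext, ax⟩ := hX
  have hbe : ∀ a t, h.Before X co a t → co a t := by
    rintro a t (hw | hs | hx)
    · exact ext _ _ (.inl hw)
    · exact ext _ _ (.inr hs)
    · cases X with
      | PC => exact hx.elim
      | SI => exact hx.1
      | SER => exact hx
  -- `pre t a`: the transaction `a` commits before the snapshot of `t`
  let pre : T → T → Prop := fun t a => ∃ g, h.Before X co g t ∧ (a = g ∨ co a g)
  have pre_co : ∀ t a, pre t a → co a t := by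
    rintro t a ⟨g, hg, rfl | hag⟩
    · exact hbe _ _ hg
    · exact tr _ _ _ hag (hbe _ _ hg)
  have pre_down : ∀ t a b, co a b → pre t b → pre t a := by
    rintro t a b hab ⟨g, hg, rfl | hbg⟩
    · exact ⟨b, hg, .inr hab⟩
    · exact ⟨g, hg, .inr (tr _ _ _ hab hbg)⟩
  have asym : ∀ a b, co a b → ¬ co b a := fun a b h1 h2 => irr _ (tr _ _ _ h1 h2)
  -- snapshots are ordered by the sets of transactions that precede them
  let lt : Event T → Event T → Prop := fun a b =>
    (a.1 = 1 ∧ b.1 = 1 ∧ co a.2 b.2) ∨ (a.1 = 1 ∧ b.1 = 0 ∧ pre b.2 a.2) ∨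
    (a.1 = 0 ∧ b.1 = 1 ∧ ¬ pre a.2 b.2) ∨
    (a.1 = 0 ∧ b.1 = 0 ∧ ((∀ t, pre a.2 t ↔ pre b.2 t) ∧ co a.2 b.2 ∨
      ∃ t, pre b.2 t ∧ ¬ pre a.2 t))
  have hnot : ∀ t a b, pre t a → ¬ pre t b → co a b := fun t a b ha hb => by
    by_cases hab : a = b
    · exact absurd (hab ▸ ha) hb
    · exact (tot a b hab).resolve_right fun hba => hb (pre_down t b a hba ha)
  have fin2 : ∀ i : Fin 2, i = 0 ∨ i = 1 := by decide
  have hread : ∀ (r : Fin 2) (a b c : Event T), h.ReadForbids r a b c → lt a b → lt b c →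
      ∀ x, h.wrOn x a.2 c.2 → h.Writes b.2 x → ¬ co b.2 a.2 := by
    rintro r ⟨i, a⟩ ⟨j, b⟩ ⟨k, c⟩ ⟨⟨hi, hj, hk⟩, hne, -⟩ hab hbc x hx hw
    simp only at hi hj
    subst hi hj
    have : co a b := by simpa [lt] using hab
    exact asym _ _ this
  have hread0 : ∀ (a b c : Event T), h.PrefixAxiom co → (∀ g t, h.Before X co g t →
      (h.wr g t ∨ h.so g t) ∨ X = .SI ∧ co g t ∧ ∃ x, h.Writes g x ∧ h.Writes t x) →
      (X = .SI → h.ConflictAxiom co) → h.ReadForbids 0 a b c → ¬ (lt a b ∧ lt b c) := by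
    rintro ⟨i, a⟩ ⟨j, b⟩ ⟨k, c⟩ hP hB hC hF ⟨hab, hbc⟩
    obtain ⟨⟨hi, hj, hk⟩, hne, x, hx, hw⟩ := id hF
    refine hread 0 _ _ _ hF hab hbc x hx hw ?_
    simp only at hi hj hk hne hx hw
    subst hi hj hk
    have hpre : pre c b := by simpa [lt] using hbc
    obtain ⟨g, hg, hbg⟩ := hpre
    have hbg' : Relation.ReflTransGen co b g := by
      rcases hbg with rfl | hbg
      · exact .refl
      · exact .single hbg
    rcases hB g c hg with hg | ⟨hX, hg, y, hgy, hcy⟩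
    · exact hP x a b c hne hx hw ⟨g, hbg', hg⟩
    · exact hC hX x y a b c g hne hx hw hcy hgy hbg' hg
  refine ⟨lt, ?_, ?_, ?_, ?_, ?_⟩
  · rintro ⟨i, a⟩
    rcases fin2 i with rfl | rfl <;> simp [lt, irr]
  · rintro ⟨i, a⟩ ⟨j, b⟩ ⟨k, c⟩ hab hbc
    rcases fin2 i with rfl | rfl <;> rcases fin2 j with rfl | rfl <;>
      rcases fin2 k with rfl | rfl <;> simp [lt] at hab hbc ⊢
    · rcases hab with ⟨h1, h1'⟩ | ⟨t, h1, h1'⟩ <;> rcases hbc with ⟨h2, h2'⟩ | ⟨s, h2, h2'⟩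
      · exact .inl ⟨fun t => (h1 t).trans (h2 t), tr _ _ _ h1' h2'⟩
      · exact .inr ⟨s, h2, fun hs => h2' ((h1 s).1 hs)⟩
      · exact .inr ⟨t, (h2 t).1 h1, h1'⟩
      · refine .inr ⟨s, h2, fun hs => h1' (pre_down a t s (hnot b t s h1 h2') hs)⟩
    · rcases hab with ⟨h1, h1'⟩ | ⟨t, h1, h1'⟩
      · rwa [h1]
      · exact fun hc => h1' (pre_down a t c (hnot b t c h1 hbc) hc)
    · exact .inr ⟨b, hbc, hab⟩
    · exact fun hc => hab (pre_down a b c hbc hc)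
    · rcases hbc with ⟨h1, h1'⟩ | ⟨t, h1, h1'⟩
      · exact (h1 a).1 hab
      · exact pre_down c a t (hnot b a t hab h1') h1
    · exact hnot b a c hab hbc
    · exact pre_down c a b hab hbc
    · exact tr _ _ _ hab hbc
  · rintro ⟨i, a⟩ ⟨j, b⟩ - - hab
    rcases fin2 i with rfl | rfl <;> rcases fin2 j with rfl | rfl <;> simp [lt] at hab ⊢
    · by_cases hpp : ∀ t, pre a t ↔ pre b t
      · rcases tot a b hab with hab | hab
        · exact .inl (.inl ⟨hpp, hab⟩)
        · exact .inr (.inl ⟨fun t => (hpp t).symm, hab⟩)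
      · push Not at hpp
        obtain ⟨t, ⟨h1, h2⟩ | ⟨h1, h2⟩⟩ := hpp
        · exact .inr (.inr ⟨t, h1, h2⟩)
        · exact .inl (.inr ⟨t, h2, h1⟩)
    · exact (em _).symm
    · exact em _
    · exact tot a b hab
  · rintro ⟨i, a⟩ ⟨j, b⟩ - - hab
    rcases hab with ⟨he, hlt⟩ | hab
    · simp only at he hlt
      subst he
      rcases fin2 i with rfl | rfl <;> rcases fin2 j with rfl | rfl <;> simp at hlt
      simp only [lt]
      exact .inr (.inr (.inl ⟨trivial, trivial, fun hp => irr _ (pre_co _ _ hp)⟩))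
    · simp only at hab
      have hB : h.Before X co a b := hab.elim (fun h => .inr (.inl h)) .inl
      have hco : co a b := hbe _ _ hB
      have hp : pre b a := ⟨a, hB, .inl rfl⟩
      rcases fin2 i with rfl | rfl <;> rcases fin2 j with rfl | rfl <;> simp [lt]
      · exact .inr ⟨a, hp, fun ha => irr _ (pre_co _ _ ha)⟩
      · exact fun hb => asym _ _ hco (pre_co _ _ hb)
      · exact hp
      · exact hco
  · intro a b c _ _ _ hF
    cases X with
    | PC =>
      exact hread0 a b c ax (fun g t hg => .inl (by simpa [Before] using hg))
        (fun hX => nomatch hX) hF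
    | SI =>
      rcases hF with hF | hF
      · exact hread0 a b c ax.1 (fun g t hg => by
          rcases hg with hg | hg | hg
          · exact .inl (.inl hg)
          · exact .inl (.inr hg)
          · exact .inr ⟨rfl, hg⟩) (fun _ => ax.2) hF
      · rintro ⟨hab, hbc⟩
        obtain ⟨i, a⟩ := a
        obtain ⟨j, b⟩ := b
        obtain ⟨k, c⟩ := c
        obtain ⟨⟨hi, hj, hk⟩, hac, hne, x, hb, hc⟩ := hF
        simp only at hi hj hk hac hne hb hc
        subst hi hj hk hac
        have h1 : ¬ pre a b := by simpa [lt] using hab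
        have h2 : co b a := by simpa [lt] using hbc
        exact h1 ⟨b, .inr (.inr ⟨h2, x, hb, hc⟩), .inl rfl⟩
    | SER =>
      rintro ⟨hab, hbc⟩
      obtain ⟨⟨hi, hj, hk⟩, hne, x, hx, hw⟩ := id hF
      refine hread 1 _ _ _ hF hab hbc x hx hw (ax x a.2 b.2 c.2 hne hx hw ?_)
      simpa [lt, hi, hj, hk] using hbc

end History

/-! ## Merging orders along a decomposition into biconnected parts -/

/-- Two strict total orders on `A` and `B` that agree on `A ∩ B` have a common extension. -/
theorem exists_lt_of_agree {E : Type*} {A B : Set E} {r s : E → E → Prop}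
    (hr : ∀ a, ¬ r a a) (hr' : ∀ a b c, r a b → r b c → r a c)
    (hs : ∀ a, ¬ s a a) (hs' : ∀ a b c, s a b → s b c → s a c)
    (hrs : ∀ a b, a ∈ A ∩ B → b ∈ A ∩ B → (r a b ↔ s a b)) :
    ∃ lt : E → E → Prop, (∀ a, ¬ lt a a) ∧ (∀ a b c, lt a b → lt b c → lt a c) ∧
      (∀ a b, a ≠ b → lt a b ∨ lt b a) ∧ (∀ a b, a ∈ A → b ∈ A → r a b → lt a b) ∧
      ∀ a b, a ∈ B → b ∈ B → s a b → lt a b := by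
  let P : E → E → Prop := fun x y => (x ∈ A ∧ y ∈ A ∧ r x y) ∨ (x ∈ B ∧ y ∈ B ∧ s x y) ∨
    (∃ c ∈ A ∩ B, x ∈ A ∧ y ∈ B ∧ r x c ∧ s c y) ∨ (∃ c ∈ A ∩ B, x ∈ B ∧ y ∈ A ∧ s x c ∧ r c y)
  have irr : ∀ x, ¬ P x x := by
    rintro x (⟨-, -, h⟩ | ⟨-, -, h⟩ | ⟨c, hc, hxA, hxB, h1, h2⟩ | ⟨c, hc, hxB, hxA, h1, h2⟩)
    · exact hr _ h
    · exact hs _ h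
    · exact hr _ (hr' _ _ _ h1 ((hrs _ _ hc ⟨hxA, hxB⟩).2 h2))
    · exact hr _ (hr' _ _ _ h2 ((hrs _ _ ⟨hxA, hxB⟩ hc).2 h1))
  have tr : ∀ x y z, P x y → P y z → P x z := by
    rintro x y z (⟨hx, hy, h⟩ | ⟨hx, hy, h⟩ | ⟨c, hc, hx, hy, h1, h2⟩ | ⟨c, hc, hx, hy, h1, h2⟩)
      (⟨ky, kz, k⟩ | ⟨ky, kz, k⟩ | ⟨d, hd, ky, kz, k1, k2⟩ | ⟨d, hd, ky, kz, k1, k2⟩)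
    · exact .inl ⟨hx, kz, hr' _ _ _ h k⟩
    · exact .inr (.inr (.inl ⟨y, ⟨hy, ky⟩, hx, kz, h, k⟩))
    · exact .inr (.inr (.inl ⟨d, hd, hx, kz, hr' _ _ _ h k1, k2⟩))
    · exact .inl ⟨hx, kz, hr' _ _ _ h (hr' _ _ _ ((hrs _ _ ⟨hy, ky⟩ hd).2 k1) k2)⟩
    · exact .inr (.inr (.inr ⟨y, ⟨ky, hy⟩, hx, kz, h, k⟩))
    · exact .inr (.inl ⟨hx, kz, hs' _ _ _ h k⟩)
    · exact .inr (.inl ⟨hx, kz, hs' _ _ _ h (hs' _ _ _ ((hrs _ _ ⟨ky, hy⟩ hd).1 k1) k2)⟩)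
    · exact .inr (.inr (.inr ⟨d, hd, hx, kz, hs' _ _ _ h k1, k2⟩))
    · exact .inl ⟨hx, kz, hr' _ _ _ (hr' _ _ _ h1 ((hrs _ _ hc ⟨ky, hy⟩).2 h2)) k⟩
    · exact .inr (.inr (.inl ⟨c, hc, hx, kz, h1, hs' _ _ _ h2 k⟩))
    · exact .inr (.inr (.inl
        ⟨d, hd, hx, kz, hr' _ _ _ (hr' _ _ _ h1 ((hrs _ _ hc ⟨ky, hy⟩).2 h2)) k1, k2⟩))
    · exact .inl ⟨hx, kz, hr' _ _ _ h1 (hr' _ _ _ ((hrs _ _ hc hd).2 (hs' _ _ _ h2 k1)) k2)⟩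
    · exact .inr (.inr (.inr ⟨c, hc, hx, kz, h1, hr' _ _ _ h2 k⟩))
    · exact .inr (.inl ⟨hx, kz, hs' _ _ _ (hs' _ _ _ h1 ((hrs _ _ hc ⟨hy, ky⟩).1 h2)) k⟩)
    · exact .inr (.inl ⟨hx, kz, hs' _ _ _ h1 (hs' _ _ _ ((hrs _ _ hc hd).1 (hr' _ _ _ h2 k1)) k2)⟩)
    · exact .inr (.inr (.inr
        ⟨d, hd, hx, kz, hs' _ _ _ (hs' _ _ _ h1 ((hrs _ _ hc ⟨hy, ky⟩).1 h2)) k1, k2⟩))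
  have : IsPartialOrder E (fun x y => x = y ∨ P x y) :=
    { refl := fun _ => .inl rfl
      trans := by
        rintro x y z (rfl | hxy) (rfl | hyz)
        · exact .inl rfl
        · exact .inr hyz
        · exact .inr hxy
        · exact .inr (tr _ _ _ hxy hyz)
      antisymm := by
        intro x y hxy hyx
        by_contra hne
        exact irr _ (tr _ _ _ (hxy.resolve_left hne) (hyx.resolve_left (Ne.symm hne))) }
  obtain ⟨le, hle, hP⟩ := extend_partialOrder (fun x y => x = y ∨ P x y)
  have hlt : ∀ x y, P x y → le x y ∧ x ≠ y := fun x y h =>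
    ⟨hP _ _ (.inr h), fun e => irr x (by rwa [← e] at h)⟩
  refine ⟨fun x y => le x y ∧ x ≠ y, fun x h => h.2 rfl, ?_, ?_, ?_, ?_⟩
  · rintro x y z ⟨h1, h2⟩ ⟨h3, h4⟩
    refine ⟨hle.trans _ _ _ h1 h3, ?_⟩
    rintro rfl
    exact h2 (hle.antisymm _ _ h1 h3)
  · exact fun x y h => (hle.total x y).imp (fun h' => ⟨h', h⟩) fun h' => ⟨h', h.symm⟩
  · exact fun x y hx hy h => hlt _ _ (.inl ⟨hx, hy, h⟩)
  · exact fun x y hx hy h => hlt _ _ (.inr (.inl ⟨hx, hy, h⟩))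

namespace SimpleGraph

variable {V V' : Type*} {G : SimpleGraph V} {G' : SimpleGraph V'}

theorem exists_isolated_of_not_preconnected (h : ¬ G.Preconnected) :
    ∃ A : Set V, A.Nonempty ∧ Aᶜ.Nonempty ∧ ∀ a ∈ A, ∀ b ∉ A, ¬ G.Adj a b := by
  simp only [Preconnected, not_forall] at h
  obtain ⟨u, v, huv⟩ := h
  exact ⟨{x | G.Reachable u x}, ⟨u, Reachable.refl u⟩, ⟨v, huv⟩,
    fun a ha b hb hab => hb (Reachable.trans ha hab.reachable)⟩

theorem preconnected_induce_compl_of_iso (e : G ≃g G') (v : V)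
    (h : (G.induce {v}ᶜ).Preconnected) : (G'.induce {e v}ᶜ).Preconnected := by
  rintro ⟨x, hx⟩ ⟨y, hy⟩
  have key : ∀ z, z ∈ ({e v}ᶜ : Set V') → e.symm z ∈ ({v}ᶜ : Set V) := fun z hz hzv =>
    hz (by rw [Set.mem_singleton_iff] at hzv ⊢; rw [← hzv]; simp)
  have hm : Set.MapsTo e ({v}ᶜ : Set V) ({e v}ᶜ : Set V') := fun z hz hzv =>
    hz (e.injective hzv)
  have := (h ⟨_, key x hx⟩ ⟨_, key y hy⟩).map (induceHom e.toHom hm)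
  convert this using 2 <;> simp

theorem isBiconnected_of_iso (e : G ≃g G') (h : IsBiconnected G) : IsBiconnected G' :=
  ⟨e.connected_iff.1 h.1, fun v => by
    obtain ⟨u, rfl⟩ := e.surjective v
    exact preconnected_induce_compl_of_iso e u (h.2 u)⟩

/-- A nonempty set of vertices that is not biconnected can be split along at most one vertex. -/
theorem exists_split_of_not_isBiconnected {W : Set V} (hW : W.Nonempty)
    (h : ¬ IsBiconnected (G.induce W)) : ∃ A B : Set V, A ∪ B = W ∧ A ≠ W ∧ B ≠ W ∧
      (A ∩ B).Subsingleton ∧ ∀ a ∈ A, ∀ b ∈ B, a ∉ B → b ∉ A → ¬ G.Adj a b := by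
  have hne : Nonempty W := hW.to_subtype
  by_cases hc : (G.induce W).Preconnected
  · have : ∃ v : W, ¬ ((G.induce W).induce {v}ᶜ).Preconnected := by
      by_contra! hv
      exact h ⟨⟨hc⟩, hv⟩
    obtain ⟨v, hv⟩ := this
    obtain ⟨A, ⟨x, hx⟩, ⟨y, hy⟩, hA⟩ := exists_isolated_of_not_preconnected hv
    let A' : Set V := {a | ∃ (ha : a ∈ W) (hav : (⟨a, ha⟩ : W) ∈ ({v}ᶜ : Set W)), ⟨⟨a, ha⟩, hav⟩ ∈ A}
    let B' : Set V := {a | ∃ (ha : a ∈ W) (hav : (⟨a, ha⟩ : W) ∈ ({v}ᶜ : Set W)), ⟨⟨a, ha⟩, hav⟩ ∉ A}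
    have hvA : v.1 ∉ A' := fun ⟨_, h, _⟩ => h rfl
    have hvB : v.1 ∉ B' := fun ⟨_, h, _⟩ => h rfl
    have hdis : ∀ a, a ∈ A' → a ∉ B' := fun a ⟨_, _, h1⟩ ⟨_, _, h2⟩ => h2 h1
    refine ⟨insert v.1 A', insert v.1 B', ?_, ?_, ?_, ?_, ?_⟩
    · ext a
      constructor
      · rintro ((rfl | ⟨ha, -⟩) | (rfl | ⟨ha, -⟩))
        exacts [v.2, ha, v.2, ha]
      · intro ha
        by_cases hav : a = v.1
        · exact .inl (.inl hav)
        have hav' : (⟨a, ha⟩ : W) ∈ ({v}ᶜ : Set W) := fun e => hav (congrArg Subtype.val e)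
        by_cases hm : ⟨⟨a, ha⟩, hav'⟩ ∈ A
        · exact .inl (.inr ⟨ha, hav', hm⟩)
        · exact .inr (.inr ⟨ha, hav', hm⟩)
    · intro e
      have hyW : y.1.1 ∈ insert v.1 A' := by rw [e]; exact y.1.2
      rcases hyW with hyv | hyA
      · exact y.2 (Subtype.ext hyv)
      · exact hdis _ hyA ⟨y.1.2, y.2, hy⟩
    · intro e
      have hxW : x.1.1 ∈ insert v.1 B' := by rw [e]; exact x.1.2
      rcases hxW with hxv | hxB
      · exact x.2 (Subtype.ext hxv)
      · exact hdis _ ⟨x.1.2, x.2, hx⟩ hxB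
    · have : ∀ a ∈ insert v.1 A' ∩ insert v.1 B', a = v.1 := by
        rintro a ⟨ha | ha, hb | hb⟩
        exacts [ha, ha, hb, absurd hb (hdis a ha)]
      exact fun a ha b hb => (this a ha).trans (this b hb).symm
    · rintro a (rfl | ⟨ha, hav, hA'⟩) b (rfl | ⟨hb, hbv, hB'⟩) haB hbA
      · exact absurd (Set.mem_insert _ _) haB
      · exact absurd (Set.mem_insert _ _) haB
      · exact absurd (Set.mem_insert _ _) hbA
      · exact hA _ hA' _ hB'
  · obtain ⟨A, ⟨x, hx⟩, ⟨y, hy⟩, hA⟩ := exists_isolated_of_not_preconnected hc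
    refine ⟨Subtype.val '' A, Subtype.val '' Aᶜ, ?_, ?_, ?_, ?_, ?_⟩
    · rw [← Set.image_union, Set.union_compl_self, Set.image_univ, Subtype.range_coe]
    · intro e
      obtain ⟨z, hz, hzy⟩ : y.1 ∈ Subtype.val '' A := by rw [e]; exact y.2
      exact hy (Subtype.ext hzy ▸ hz)
    · intro e
      obtain ⟨z, hz, hzx⟩ : x.1 ∈ Subtype.val '' Aᶜ := by rw [e]; exact x.2
      exact hz (Subtype.ext hzx ▸ hx)
    · rw [← Set.image_inter Subtype.val_injective, Set.inter_compl_self, Set.image_empty]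
      exact Set.subsingleton_empty
    · rintro _ ⟨a, ha, rfl⟩ _ ⟨b, hb, rfl⟩ - -
      exact hA a ha b hb

theorem encard_le_of_isBiconnected_induce [Finite V] {k : ℕ}
    (hG : BiconnectedComponentsBounded G k) {W : Set V} (hW : IsBiconnected (G.induce W)) :
    W.encard ≤ k := by
  rw [induce_eq_coe_induce_top] at hW
  have : Finite G.Subgraph :=
    Finite.of_injective (fun H : G.Subgraph => (H.verts, H.Adj)) fun H H' e => by
      simp only [Prod.mk.injEq] at e
      exact Subgraph.ext e.1 e.2
  obtain ⟨C, hle, hC⟩ := Finite.exists_le_maximal (p := fun H : G.Subgraph => IsBiconnected H.coe) hW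
  exact (Set.encard_le_encard hle.1).trans (hG C hC)

/-- Every biconnected induced subgraph has at most `k` vertices. -/
def BiconnectedSetsBounded (G : SimpleGraph V) (k : ℕ) : Prop :=
  ∀ W : Set V, IsBiconnected (G.induce W) → W.encard ≤ k

theorem BiconnectedSetsBounded.induce {k : ℕ} (h : G.BiconnectedSetsBounded k) (U : Set V) :
    (G.induce U).BiconnectedSetsBounded k := by
  intro W hW
  have e : (G.induce U).induce W ≃g G.induce (Subtype.val '' W) :=
    { toEquiv := Equiv.Set.image Subtype.val W Subtype.val_injective
      map_rel_iff' := by intros; rfl }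
  rw [← Subtype.val_injective.encard_image W]
  exact h _ (isBiconnected_of_iso e hW)

end SimpleGraph

namespace History

variable {T : Type} {h : History T}

theorem sameSession_symm {a b : T} (hab : h.SameSession a b) : h.SameSession b a :=
  hab.imp Eq.symm fun ⟨h1, h2, h3⟩ => ⟨h2, h1, h3.symm⟩

theorem sameSession_init_iff {t : T} : h.SameSession h.init t ↔ t = h.init :=
  ⟨fun ht => ht.elim Eq.symm fun h' => absurd rfl h'.1, fun ht => .inl ht.symm⟩

theorem wrOn_accesses {x : ℕ} {a b : T} (hab : h.wrOn x a b) :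
    h.Accesses a x ∧ h.Accesses b x := by
  obtain ⟨i, v, hi, rfl⟩ := hab
  exact ⟨.inr ⟨v, h.src_writes _ _ _ _ hi⟩, .inl ⟨v, List.mem_of_getElem? hi⟩⟩

/-- The sessions, except that of the initial transaction. -/
abbrev ProperSession (h : History T) : Type :=
  {S : {S : Set T // ∃ t, S = h.session t} | h.init ∉ S.1}

/-- The transactions in the sessions in `W`, and the initial transaction. -/
def transactionsOf (W : Set h.ProperSession) : Set T :=
  {t | t = h.init ∨ ∃ S ∈ W, t ∈ S.1.1}

/-- The session of a transaction that is not the initial one. -/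
def properSession (t : T) (ht : t ≠ h.init) : h.ProperSession :=
  ⟨⟨h.session t, t, rfl⟩, fun hi => ht (sameSession_init_iff.1 (sameSession_symm hi))⟩

theorem eq_properSession (hs : h.SessionsAreSequences) (S : h.ProperSession) {t : T}
    (ht : t ∈ S.1.1) : ∃ hne : t ≠ h.init, S = properSession t hne := by
  obtain ⟨⟨S, s, rfl⟩, hS⟩ := S
  refine ⟨fun e => hS (by rwa [e] at ht), Subtype.ext (Subtype.ext ?_)⟩
  ext u
  exact ⟨fun hu => hs _ _ _ (sameSession_symm ht) hu, fun hu => hs _ _ _ ht hu⟩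

theorem mem_transactionsOf (hs : h.SessionsAreSequences) {W : Set h.ProperSession} {t : T}
    (ht : t ≠ h.init) : t ∈ transactionsOf W ↔ properSession t ht ∈ W := by
  constructor
  · rintro (rfl | ⟨S, hS, htS⟩)
    · exact absurd rfl ht
    · obtain ⟨_, rfl⟩ := eq_properSession hs S htS
      exact hS
  · exact fun hW => .inr ⟨_, hW, .inl rfl⟩

/-- `a` and `b` are the same session, or communicate, or one of them is the initial transaction. -/
def Linked (h : History T) (a b : T) : Prop :=
  a = h.init ∨ b = h.init ∨ h.SameSession a b ∨ ∃ x, h.Accesses a x ∧ h.Accesses b x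

theorem EvLt.linked {a b : Event T} (hab : h.EvLt a b) : h.Linked a.2 b.2 := by
  by_cases hb : b.2 = h.init
  · exact .inr (.inl hb)
  by_cases ha : a.2 = h.init
  · exact .inl ha
  rcases hab with ⟨he, -⟩ | hso | ⟨x, hx⟩
  · exact .inr (.inr (.inl (.inl he)))
  · exact .inr (.inr (.inl (.inr ⟨ha, hb, .inl hso⟩)))
  · exact .inr (.inr (.inr ⟨x, wrOn_accesses hx⟩))

theorem ReadForbids.linked {r : Fin 2} {a b c : Event T} (hF : h.ReadForbids r a b c) :
    h.Linked a.2 b.2 ∧ h.Linked b.2 c.2 ∧ h.Linked a.2 c.2 := by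
  obtain ⟨-, -, x, hx, hw⟩ := hF
  have := wrOn_accesses hx
  exact ⟨.inr (.inr (.inr ⟨x, this.1, .inr hw⟩)), .inr (.inr (.inr ⟨x, .inr hw, this.2⟩)),
    .inr (.inr (.inr ⟨x, this.1, this.2⟩))⟩

theorem ConflictForbids.linked {a b c : Event T} (hF : h.ConflictForbids a b c) :
    h.Linked a.2 b.2 ∧ h.Linked b.2 c.2 ∧ h.Linked a.2 c.2 := by
  obtain ⟨-, he, -, x, hb, hc⟩ := hF
  rw [he]
  exact ⟨.inr (.inr (.inr ⟨x, .inr hc, .inr hb⟩)), .inr (.inr (.inr ⟨x, .inr hb, .inr hc⟩)),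
    .inr (.inr (.inl (.inl rfl)))⟩

theorem Forbids.linked {X : Criterion} {a b c : Event T} (hF : h.Forbids X a b c) :
    h.Linked a.2 b.2 ∧ h.Linked b.2 c.2 ∧ h.Linked a.2 c.2 := by
  cases X with
  | PC => exact ReadForbids.linked hF
  | SI => exact hF.elim ReadForbids.linked ConflictForbids.linked
  | SER => exact ReadForbids.linked hF

theorem EvLt.total_of_sameSession {a b : Event T} (hab : a ≠ b)
    (h' : h.SameSession a.2 b.2 ∨ a.2 = h.init ∨ b.2 = h.init) : h.EvLt a b ∨ h.EvLt b a := by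
  by_cases he : a.2 = b.2
  · have : a.1 ≠ b.1 := fun e => hab (Prod.ext e he)
    rcases lt_or_gt_of_ne this with hlt | hlt
    · exact .inl (.inl ⟨he, hlt⟩)
    · exact .inr (.inl ⟨he.symm, hlt⟩)
  · rcases h' with h' | ha | hb
    · rcases h' with h' | ⟨-, -, h' | h'⟩
      · exact absurd h' he
      · exact .inl (.inr (.inl h'))
      · exact .inr (.inr (.inl h'))
    · exact .inl (.inr (.inl (ha ▸ h.init_first _ fun e => he (ha.trans e.symm))))
    · exact .inr (.inr (.inl (hb ▸ h.init_first _ fun e => he (e.trans hb.symm))))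

/-- Orders for two sets of transactions that are joined by at most one session can be merged. -/
theorem Orderable.union {X : Criterion} {A B : Set T} (hA : h.Orderable X A)
    (hB : h.Orderable X B)
    (hAB : ∀ a b, a ∈ A ∩ B → b ∈ A ∩ B → h.SameSession a b ∨ a = h.init ∨ b = h.init)
    (hcross : ∀ a b, a ∈ A → b ∈ B → a ∉ B → b ∉ A → ¬ h.Linked a b) :
    h.Orderable X (A ∪ B) := by
  obtain ⟨r, hr, hr', r3, r4, r5⟩ := hA
  obtain ⟨s, hs, hs', s3, s4, s5⟩ := hB
  obtain ⟨lt, h1, h2, h3, h4, h5⟩ := exists_lt_of_agree (A := {a : Event T | a.2 ∈ A})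
    (B := {a : Event T | a.2 ∈ B}) hr hr' hs hs' (fun a b ha hb => by
      by_cases hab : a = b
      · subst hab
        exact ⟨fun h => absurd h (hr _), fun h => absurd h (hs _)⟩
      rcases EvLt.total_of_sameSession hab (hAB a.2 b.2 ha hb) with h | h
      · exact ⟨fun _ => s4 _ _ ha.2 hb.2 h, fun _ => r4 _ _ ha.1 hb.1 h⟩
      · exact ⟨fun h' => absurd (hr' _ _ _ h' (r4 _ _ hb.1 ha.1 h)) (hr _),
          fun h' => absurd (hs' _ _ _ h' (s4 _ _ hb.2 ha.2 h)) (hs _)⟩)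
  have symm : ∀ a b, h.Linked a b → h.Linked b a := by
    rintro a b (h | h | h | ⟨x, h, h'⟩)
    exacts [.inr (.inl h), .inl h, .inr (.inr (.inl (sameSession_symm h))),
      .inr (.inr (.inr ⟨x, h', h⟩))]
  have pair : ∀ a b, a ∈ A ∪ B → b ∈ A ∪ B → h.Linked a b → a ∉ A → b ∈ B :=
    fun a b ha hb hl hA => by_contra fun hB =>
      hcross b a (hb.resolve_right hB) (ha.resolve_left hA) hB hA (symm _ _ hl)
  have lt_of_r : ∀ a b, a.2 ∈ A → b.2 ∈ A → lt a b → r a b := fun a b ha hb hab => by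
    refine (r3 a b ha hb fun e => h1 b (e ▸ hab)).resolve_right fun hba => ?_
    exact h1 _ (h2 _ _ _ hab (h4 _ _ hb ha hba))
  have lt_of_s : ∀ a b, a.2 ∈ B → b.2 ∈ B → lt a b → s a b := fun a b ha hb hab => by
    refine (s3 a b ha hb fun e => h1 b (e ▸ hab)).resolve_right fun hba => ?_
    exact h1 _ (h2 _ _ _ hab (h5 _ _ hb ha hba))
  refine ⟨lt, h1, h2, fun a b _ _ => h3 a b, fun a b ha hb hab => ?_,
    fun a b c ha hb hc hF hlt => ?_⟩
  · by_cases hA : a.2 ∈ A ∧ b.2 ∈ A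
    · exact h4 _ _ hA.1 hA.2 (r4 _ _ hA.1 hA.2 hab)
    · have hB : a.2 ∈ B ∧ b.2 ∈ B := by
        by_cases hA' : a.2 ∈ A
        · have hb' : b.2 ∉ A := fun hb' => hA ⟨hA', hb'⟩
          exact ⟨pair _ _ hb ha (symm _ _ hab.linked) hb', hb.resolve_left hb'⟩
        · exact ⟨ha.resolve_left hA', pair _ _ ha hb hab.linked hA'⟩
      exact h5 _ _ hB.1 hB.2 (s4 _ _ hB.1 hB.2 hab)
  · obtain ⟨l1, l2, l3⟩ := hF.linked
    by_cases hA : a.2 ∈ A ∧ b.2 ∈ A ∧ c.2 ∈ A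
    · obtain ⟨i1, i2, i3⟩ := hA
      exact r5 a b c i1 i2 i3 hF ⟨lt_of_r _ _ i1 i2 hlt.1, lt_of_r _ _ i2 i3 hlt.2⟩
    · have hB : a.2 ∈ B ∧ b.2 ∈ B ∧ c.2 ∈ B := by
        by_cases hA₁ : a.2 ∈ A
        · by_cases hA₂ : b.2 ∈ A
          · have hA₃ : c.2 ∉ A := fun h' => hA ⟨hA₁, hA₂, h'⟩
            exact ⟨pair _ _ hc ha (symm _ _ l3) hA₃, pair _ _ hc hb (symm _ _ l2) hA₃,
              hc.resolve_left hA₃⟩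
          · exact ⟨pair _ _ hb ha (symm _ _ l1) hA₂, hb.resolve_left hA₂, pair _ _ hb hc l2 hA₂⟩
        · exact ⟨ha.resolve_left hA₁, pair _ _ ha hb l1 hA₁, pair _ _ ha hc l3 hA₁⟩
      obtain ⟨i1, i2, i3⟩ := hB
      exact s5 a b c i1 i2 i3 hF ⟨lt_of_s _ _ i1 i2 hlt.1, lt_of_s _ _ i2 i3 hlt.2⟩

theorem orderable_transactionsOf [Finite T] {X : Criterion} (hs : h.SessionsAreSequences) {k : ℕ}
    (hk : h.properComm.BiconnectedSetsBounded k)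
    (hX : ∀ W : Set h.ProperSession, W.encard ≤ k → h.Orderable X (transactionsOf W))
    (W : Set h.ProperSession) : h.Orderable X (transactionsOf W) := by
  induction hn : W.ncard using Nat.strong_induction_on generalizing W with
  | _ n ih =>
    subst hn
    rcases W.eq_empty_or_nonempty with rfl | hW
    · exact hX _ (by simp)
    by_cases hb : IsBiconnected (h.properComm.induce W)
    · exact hX _ (hk W hb)
    obtain ⟨A, B, rfl, hA, hB, hAB, hcross⟩ :=
      SimpleGraph.exists_split_of_not_isBiconnected hW hb
    have oA := ih _ (Set.ncard_lt_ncard (Set.subset_union_left.ssubset_of_ne hA)) A rfl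
    have oB := ih _ (Set.ncard_lt_ncard (Set.subset_union_right.ssubset_of_ne hB)) B rfl
    refine (oA.union oB ?_ ?_).mono ?_
    · rintro a b ⟨ha, ha'⟩ ⟨hb, hb'⟩
      by_cases hai : a = h.init
      · exact .inr (.inl hai)
      by_cases hbi : b = h.init
      · exact .inr (.inr hbi)
      rw [mem_transactionsOf hs hai] at ha ha'
      rw [mem_transactionsOf hs hbi] at hb hb'
      have e : h.session a = h.session b :=
        congrArg (fun S : h.ProperSession => S.1.1) (hAB ⟨ha, ha'⟩ ⟨hb, hb'⟩)
      have : b ∈ h.session a := e ▸ .inl rfl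
      exact .inl this
    · intro a b ha hb haB hbA hl
      have hai : a ≠ h.init := fun e => haB (.inl e)
      have hbi : b ≠ h.init := fun e => hbA (.inl e)
      rw [mem_transactionsOf hs hai] at ha haB
      rw [mem_transactionsOf hs hbi] at hb hbA
      rcases hl with h' | h' | h' | ⟨x, hxa, hxb⟩
      · exact hai h'
      · exact hbi h'
      · have hm : a ∈ (properSession b hbi).1.1 := sameSession_symm h'
        obtain ⟨_, e⟩ := eq_properSession hs _ hm
        exact haB (e ▸ hb)
      · refine hcross _ ha _ hb haB hbA ⟨fun e => haB ?_, a, .inl rfl, b, .inl rfl, x, hxa, hxb⟩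
        have e' : properSession a hai = properSession b hbi := Subtype.ext e
        exact e' ▸ hb
    · rintro t (rfl | ⟨S, hS | hS, ht⟩)
      · exact .inl (.inl rfl)
      · exact .inl (.inr ⟨S, hS, ht⟩)
      · exact .inr (.inr ⟨S, hS, ht⟩)

theorem satisfies_iff_forall_orderable [Finite T] {X : Criterion} (hs : h.SessionsAreSequences)
    {k : ℕ} (hk : h.properComm.BiconnectedSetsBounded k) : h.Satisfies X ↔
      ∀ W : Set h.ProperSession, W.encard ≤ k → h.Orderable X (transactionsOf W) := by
  refine ⟨fun hX W _ => hX.orderable.mono (Set.subset_univ _), fun hX => Orderable.satisfies ?_⟩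
  refine (orderable_transactionsOf hs hk hX Set.univ).mono fun t _ => ?_
  by_cases ht : t = h.init
  · exact .inl ht
  · exact (mem_transactionsOf hs ht).2 trivial

end History

/-! ## Searching for an order of the events of boundedly many sessions -/

namespace History

variable {T : Type} (h : History T) {K : ℕ}

/-- The order of the events of a session. -/
def SessionLt (a b : Event T) : Prop := (a.2 = b.2 ∧ a.1 < b.1) ∨ h.so a.2 b.2

/-- `t` is the initial transaction or belongs to the session of one of the `s i`. -/
def Selected (s : Fin K → Event T) (t : T) : Prop :=
  t = h.init ∨ ∃ i, h.SameSession (s i).2 t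

/-- The events that have happened if `p i` are the last events of some sessions. -/
def Done (p : Fin K → Event T) (e : Event T) : Prop := ∃ i, e = p i ∨ h.SessionLt e (p i)

/-- The state of the search in which only the initial transaction has happened. -/
def startState : Fin K → Event T := fun _ => (1, h.init)

/-- From the state `p`, the event `e` of one of the sessions `s i` may happen, which leads to the
state `q`. -/
def Step (X : Criterion) (s p q : Fin K → Event T) : Prop :=
  ∃ (i : Fin K) (e : Event T), (h.Selected s e.2 ∧ ¬ h.Done p e ∧ h.SessionLt (p i) e) ∧
    (∀ a, h.Selected s a.2 → h.EvLt a e → h.Done p a) ∧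
    (∀ a c, h.Selected s a.2 → h.Selected s c.2 → h.Forbids X a e c → h.Done p a →
      h.Done p c ∨ c = e) ∧
    ∀ j, q j = if j = i then e else p j

/-- Some sequence of steps makes all events of the sessions `s i` happen. -/
def Completable (X : Criterion) (s : Fin K → Event T) : Prop :=
  ∃ p, Relation.ReflTransGen (h.Step X s) h.startState p ∧ ∀ a, h.Selected s a.2 → h.Done p a

variable {h}

theorem SessionLt.trans {a b c : Event T} (hab : h.SessionLt a b) (hbc : h.SessionLt b c) :
    h.SessionLt a c := by
  rcases hab with ⟨h1, h2⟩ | hab <;> rcases hbc with ⟨h3, h4⟩ | hbc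
  · exact .inl ⟨h1.trans h3, h2.trans h4⟩
  · exact .inr (h1 ▸ hbc)
  · exact .inr (h3 ▸ hab)
  · exact .inr (h.so_trans _ _ _ hab hbc)

theorem SessionLt.evLt {a b : Event T} (hab : h.SessionLt a b) : h.EvLt a b :=
  hab.imp_right .inl

theorem Selected.of_so (hs : h.SessionsAreSequences) {s : Fin K → Event T} {a b : T}
    (hb : h.Selected s b) (hab : h.so a b) : h.Selected s a := by
  by_cases ha : a = h.init
  · exact .inl ha
  rcases hb with rfl | ⟨i, hi⟩
  · exact absurd hab (h.not_so_init _)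
  · refine .inr ⟨i, hs _ _ _ hi (.inr ⟨?_, ha, .inr hab⟩)⟩
    rintro rfl
    exact h.not_so_init _ hab

theorem Selected.of_sessionLt (hs : h.SessionsAreSequences) {s : Fin K → Event T} {a b : Event T}
    (hb : h.Selected s b.2) (hab : h.SessionLt a b) : h.Selected s a.2 := by
  rcases hab with ⟨he, -⟩ | hab
  · rwa [he]
  · exact hb.of_so hs hab

theorem done_step_iff (hs : h.SessionsAreSequences) {s p q : Fin K → Event T} {i : Fin K}
    {e : Event T} (he : h.Selected s e.2) (hp : h.SessionLt (p i) e)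
    (hpre : ∀ a, h.Selected s a.2 → h.EvLt a e → h.Done p a)
    (hq : ∀ j, q j = if j = i then e else p j) (a : Event T) :
    h.Done q a ↔ h.Done p a ∨ a = e := by
  constructor
  · rintro ⟨j, hj⟩
    rw [hq] at hj
    split_ifs at hj with hji
    · rcases hj with rfl | hj
      · exact .inr rfl
      · exact .inl (hpre a (he.of_sessionLt hs hj) hj.evLt)
    · exact .inl ⟨j, hj⟩
  · rintro (⟨j, hj⟩ | rfl)
    · by_cases hji : j = i
      · subst hji
        refine ⟨j, .inr ?_⟩
        rw [hq, if_pos rfl]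
        rcases hj with rfl | hj
        · exact hp
        · exact hj.trans hp
      · refine ⟨j, ?_⟩
        rwa [hq, if_neg hji]
    · exact ⟨i, .inl (by rw [hq, if_pos rfl])⟩

theorem fin_two_eq_one_or_lt (i : Fin 2) : i = 1 ∨ i < 1 := by
  revert i
  decide

theorem done_startState_iff [NeZero K] (a : Event T) :
    h.Done (h.startState : Fin K → Event T) a ↔ a.2 = h.init := by
  constructor
  · rintro ⟨i, rfl | ⟨h1, -⟩ | h1⟩
    · rfl
    · exact h1
    · exact absurd h1 (h.not_so_init _)
  · intro ha
    refine ⟨0, ?_⟩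
    rcases fin_two_eq_one_or_lt a.1 with h1 | h1
    · exact .inl (Prod.ext h1 ha)
    · exact .inr (.inl ⟨ha, h1⟩)

theorem Forbids.eq_of_init {X : Criterion} {a b c : Event T} (hF : h.Forbids X a b c)
    (ha : a.2 = h.init) (hb : b.2 = h.init) : False := by
  have key : ∀ r, ¬ h.ReadForbids r a b c := fun r hF => hF.2.1 (ha.trans hb.symm)
  cases X with
  | PC => exact key _ hF
  | SI =>
    rcases hF with hF | hF
    · exact key _ hF
    · exact hF.2.2.1 (hb.trans (ha.symm.trans hF.2.1))
  | SER => exact key _ hF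

theorem Completable.orderable [NeZero K] (hs : h.SessionsAreSequences) {X : Criterion}
    {s : Fin K → Event T} (hc : h.Completable X s) : h.Orderable X {t | h.Selected s t} := by
  classical
  obtain ⟨p, hp, hfull⟩ := hc
  have inv : ∃ (f : Event T → ℕ) (N : ℕ), (∀ a, h.Done p a → f a < N) ∧
      (∀ a b, h.Done p a → h.Done p b → f a = f b → a = b) ∧
      (∀ a b, h.Selected s a.2 → h.Done p b → h.EvLt a b → h.Done p a ∧ f a < f b) ∧
      ∀ a b c, h.Selected s a.2 → h.Selected s c.2 → h.Forbids X a b c → h.Done p a →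
        h.Done p b → f a < f b → h.Done p c ∧ f c ≤ f b := by
    clear hfull
    induction hp with
    | refl =>
      simp only [done_startState_iff]
      refine ⟨fun a => a.1, 2, fun a _ => a.1.2, fun a b ha hb hab =>
        Prod.ext (Fin.ext hab) (ha.trans hb.symm), fun a b _ hb hab => ?_,
        fun a b c _ _ hF ha hb => (hF.eq_of_init ha hb).elim⟩
      rcases hab with ⟨h1, h2⟩ | h1 | h1
      · exact ⟨h1.trans hb, h2⟩
      · exact absurd (hb ▸ h1) (h.not_so_init _)
      · exact absurd (hb ▸ h1) (h.not_wr_init _)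
    | @tail p q _ hstep ih =>
      obtain ⟨f, N, f1, f2, f3, f4⟩ := ih
      obtain ⟨i, e, ⟨he, hne, hpi⟩, hpre, hforb, hq⟩ := hstep
      have hD := done_step_iff hs he hpi hpre hq
      have hold : ∀ a, h.Done p a → Function.update f e N a = f a := fun a ha =>
        Function.update_of_ne (fun e' : a = e => hne (e' ▸ ha)) _ _
      have hnew : Function.update f e N e = N := Function.update_self ..
      have hle : ∀ a, h.Done q a → Function.update f e N a ≤ N := fun a ha => by
        rcases (hD a).1 ha with ha | rfl
        · rw [hold a ha]
          exact (f1 a ha).le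
        · rw [hnew]
      refine ⟨Function.update f e N, N + 1, fun a ha => Nat.lt_succ_of_le (hle a ha), ?_, ?_, ?_⟩
      · intro a b ha hb hab
        rcases (hD a).1 ha with ha | rfl <;> rcases (hD b).1 hb with hb | rfl
        · rw [hold a ha, hold b hb] at hab
          exact f2 a b ha hb hab
        · rw [hold a ha, hnew] at hab
          exact absurd hab (f1 a ha).ne
        · rw [hold b hb, hnew] at hab
          exact absurd hab.symm (f1 b hb).ne
        · rfl
      · intro a b ha hb hab
        rcases (hD b).1 hb with hb | rfl
        · obtain ⟨h1, h2⟩ := f3 a b ha hb hab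
          rw [hold a h1, hold b hb]
          exact ⟨(hD a).2 (.inl h1), h2⟩
        · have h1 := hpre a ha hab
          rw [hold a h1, hnew]
          exact ⟨(hD a).2 (.inl h1), f1 a h1⟩
      · intro a b c ha hc hF hda hdb hab
        have hda' : h.Done p a := ((hD a).1 hda).resolve_right fun e' => by
          rw [e', hnew] at hab
          exact absurd (hle b hdb) (not_le.2 hab)
        rcases (hD b).1 hdb with hdb' | rfl
        · rw [hold a hda', hold b hdb'] at hab
          obtain ⟨h1, h2⟩ := f4 a b c ha hc hF hda' hdb' hab
          rw [hold c h1, hold b hdb']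
          exact ⟨(hD c).2 (.inl h1), h2⟩
        · have h1 := (hD c).2 (hforb a c ha hc hF hda')
          exact ⟨h1, by rw [hnew]; exact hle c h1⟩
  obtain ⟨f, N, f1, f2, f3, f4⟩ := inv
  refine ⟨fun a b => f a < f b, fun a => lt_irrefl _, fun a b c => lt_trans,
    fun a b ha hb hab => ?_, fun a b ha hb hab => (f3 a b ha (hfull b hb) hab).2,
    fun a b c ha hb hc hF hlt => ?_⟩
  · exact lt_or_gt_of_ne fun e => hab (f2 a b (hfull a ha) (hfull b hb) e)
  · exact absurd (f4 a b c ha hc hF (hfull a ha) (hfull b hb) hlt.1).2 (not_le.2 hlt.2)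

theorem Orderable.completable [Finite T] [NeZero K] (hs : h.SessionsAreSequences) {X : Criterion}
    {s : Fin K → Event T} (hX : h.Orderable X {t | h.Selected s t}) : h.Completable X s := by
  obtain ⟨lt, irr, tr, tot, ext, forb⟩ := hX
  suffices H : ∀ (n : ℕ) (p : Fin K → Event T),
      {a : Event T | h.Selected s a.2 ∧ ¬ h.Done p a}.ncard = n →
      (∀ a : Event T, a.2 = h.init → h.Done p a) →
      (∀ a b, h.Selected s a.2 → h.Selected s b.2 → h.Done p b → lt a b → h.Done p a) →
      (∀ i, p i = (1, h.init) ∨ h.SameSession (s i).2 (p i).2) →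
      ∃ q, Relation.ReflTransGen (h.Step X s) p q ∧ ∀ a, h.Selected s a.2 → h.Done q a by
    refine H _ h.startState rfl (fun a ha => (done_startState_iff a).2 ha) ?_ fun i => .inl rfl
    intro a b ha hb hdb hab
    rw [done_startState_iff] at hdb ⊢
    by_contra hne
    refine irr _ (tr _ _ _ hab (ext _ _ hb ha (.inr (.inl ?_))))
    rw [hdb]
    exact h.init_first _ hne
  intro n
  induction n with
  | zero =>
    intro p hn _ _ _
    refine ⟨p, .refl, fun a ha => by_contra fun hna => ?_⟩
    rw [Set.ncard_eq_zero] at hn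
    exact Set.eq_empty_iff_forall_notMem.1 hn a ⟨ha, hna⟩
  | succ n ih =>
    intro p hn hinit hdown hpos
    have hne : {a : Event T | h.Selected s a.2 ∧ ¬ h.Done p a}.Nonempty := by
      rw [← Set.ncard_pos, hn]
      exact Nat.succ_pos n
    have : IsTrans (Event T) lt := ⟨tr⟩
    have : Std.Irrefl lt := ⟨irr⟩
    obtain ⟨e, ⟨he, hed⟩, hmin⟩ :=
      (Finite.wellFounded_of_trans_of_irrefl lt).has_min _ hne
    have hei : e.2 ≠ h.init := fun e' => hed (hinit e e')
    obtain ⟨i, hi⟩ := he.resolve_left hei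
    have hpi : h.SessionLt (p i) e := by
      rcases hpos i with hp | hp
      · rw [hp]
        exact .inr (h.init_first _ hei)
      · rcases hs _ _ _ (sameSession_symm hp) hi with heq | ⟨-, -, hso | hso⟩
        · rcases lt_trichotomy (p i).1 e.1 with hlt | heq' | hlt
          · exact .inl ⟨heq, hlt⟩
          · exact absurd ⟨i, .inl (Prod.ext heq'.symm heq.symm)⟩ hed
          · exact absurd ⟨i, .inr (.inl ⟨heq.symm, hlt⟩)⟩ hed
        · exact .inr hso
        · exact absurd ⟨i, .inr (.inr hso)⟩ hed
    have hbefore : ∀ a, h.Selected s a.2 → lt a e → h.Done p a := fun a ha hae =>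
      by_contra fun hna => hmin a ⟨ha, hna⟩ hae
    have hpre : ∀ a, h.Selected s a.2 → h.EvLt a e → h.Done p a := fun a ha hae =>
      hbefore a ha (ext a e ha he hae)
    have hD := done_step_iff hs he hpi hpre (q := fun j => if j = i then e else p j) fun j => rfl
    obtain ⟨q, hq, hfull⟩ := ih (fun j => if j = i then e else p j) (by
      have hset : {a : Event T | h.Selected s a.2 ∧ ¬ h.Done (fun j => if j = i then e else p j) a}
          = {a : Event T | h.Selected s a.2 ∧ ¬ h.Done p a} \ {e} := by
        ext a
        simp only [Set.mem_ofPred_eq, hD, Set.mem_sdiff, Set.mem_singleton_iff]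
        tauto
      have hme : e ∈ {a : Event T | h.Selected s a.2 ∧ ¬ h.Done p a} := ⟨he, hed⟩
      rw [hset, Set.ncard_sdiff_singleton_of_mem hme, hn]
      rfl) (fun a ha => (hD a).2 (.inl (hinit a ha))) (by
      intro a b ha hb hdb hab
      rcases (hD b).1 hdb with hdb | rfl
      · exact (hD a).2 (.inl (hdown a b ha hb hdb hab))
      · exact (hD a).2 (.inl (hbefore a ha hab))) (by
      intro j
      by_cases hj : j = i
      · subst hj
        simpa using .inr hi
      · simpa [hj] using hpos j)
    refine ⟨q, .head ⟨i, e, ⟨he, hed, hpi⟩, hpre, ?_, fun j => rfl⟩ hq, hfull⟩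
    intro a c ha hc hF hda
    have hae : lt a e := (tot a e ha he fun e' => hed (e' ▸ hda)).resolve_right fun hea =>
      hed (hdown e a he ha hda hea)
    by_cases hce : c = e
    · exact .inr hce
    · exact .inl (hbefore c hc ((tot e c he hc (Ne.symm hce)).resolve_left fun hec =>
        forb a e c ha he hc hF ⟨hae, hec⟩))

theorem exists_selected_eq [Finite T] {k : ℕ}
    {W : Set h.ProperSession} (hW : W.encard ≤ k) :
    ∃ s : Fin (k + 1) → Event T, transactionsOf W = {t | h.Selected s t} := by
  classical
  have hfin : W.Finite := Set.toFinite W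
  have hlen : hfin.toFinset.toList.length ≤ k := by
    rw [Finset.length_toList, ← Set.ncard_eq_toFinset_card W hfin]
    rw [← hfin.cast_ncard_eq] at hW
    exact_mod_cast hW
  have hmem : ∀ S, S ∈ W ↔ ∃ i : ℕ, hfin.toFinset.toList[i]? = some S := fun S => by
    rw [← List.mem_iff_getElem?, Finset.mem_toList, Set.Finite.mem_toFinset]
  refine ⟨fun i => (0, (hfin.toFinset.toList[(i : ℕ)]?.map fun S => S.1.2.choose).getD h.init), ?_⟩
  have hch : ∀ S : h.ProperSession, S.1.1 = h.session S.1.2.choose := fun S => S.1.2.choose_spec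
  ext t
  constructor
  · rintro (ht | ⟨S, hS, ht⟩)
    · exact .inl ht
    · obtain ⟨i, hi⟩ := (hmem S).1 hS
      have hik : i < k + 1 := by
        have := (List.getElem?_eq_some_iff.1 hi).1
        omega
      refine .inr ⟨⟨i, hik⟩, ?_⟩
      simp only [hi, Option.map_some, Option.getD_some]
      rw [hch S] at ht
      exact ht
  · rintro (ht | ⟨i, hi⟩)
    · exact .inl ht
    · cases hS : hfin.toFinset.toList[(i : ℕ)]? with
      | none =>
        simp only [hS, Option.map_none, Option.getD_none] at hi
        exact .inl (sameSession_init_iff.1 hi)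
      | some S =>
        simp only [hS, Option.map_some, Option.getD_some] at hi
        refine .inr ⟨S, (hmem S).2 ⟨i, hS⟩, ?_⟩
        rw [hch S]
        exact hi

theorem satisfies_iff_forall_completable [Finite T] {X : Criterion} (hs : h.SessionsAreSequences)
    {k : ℕ} (hk : h.properComm.BiconnectedSetsBounded k) :
    h.Satisfies X ↔ ∀ s : Fin (k + 1) → Event T, h.Completable X s := by
  constructor
  · exact fun hX s => Orderable.completable hs (hX.orderable.mono (Set.subset_univ _))
  · intro hc
    refine (satisfies_iff_forall_orderable hs hk).2 fun W hW => ?_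
    obtain ⟨s, hsW⟩ := exists_selected_eq hW
    rw [hsW]
    exact (hc s).orderable hs

end History

/-! ## The search in polynomial time -/

namespace RAM

open FiniteHistory

variable {d K : ℕ}

/-- An event of the history that is computed in polynomial time. -/
structure PolyEvent (d : ℕ) (e : ∀ H : FiniteHistory, (Fin d → ℕ) → History.Event (Fin H.n)) :
    Prop where
  part : PolyFn FiniteHistory.encode d (fun H v => ((e H v).1 : ℕ))
  txn : PolyTxn d (fun H v => (e H v).2)

/-- A tuple of events of the history that is computed in polynomial time. -/
def PolyState (d : ℕ)
    (p : ∀ H : FiniteHistory, (Fin d → ℕ) → Fin K → History.Event (Fin H.n)) : Prop :=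
  ∀ i, PolyEvent d (fun H v => p H v i)

section

variable {a b c : ∀ H : FiniteHistory, (Fin d → ℕ) → History.Event (Fin H.n)}
  {s p q : ∀ H : FiniteHistory, (Fin d → ℕ) → Fin K → History.Event (Fin H.n)}

theorem PolyEvent.weaken (ha : PolyEvent d a) :
    PolyEvent (d + 1) (fun H v => a H (fun i => v i.succ)) :=
  ⟨ha.part.rename Fin.succ, ha.txn.weaken⟩

theorem PolyState.weaken (hp : PolyState d p) :
    PolyState (d + 1) (fun H v => p H (fun i => v i.succ)) :=
  fun i => (hp i).weaken

theorem PolyEvent.eq (ha : PolyEvent d a) (hb : PolyEvent d b) :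
    PolyRel FiniteHistory.encode d (fun H v => a H v = b H v) :=
  ((PolyRel.eq ha.part hb.part).and (.eq ha.txn hb.txn)).congr fun _ _ => by
    rw [Prod.ext_iff, Fin.ext_iff, Fin.ext_iff]

theorem PolyEvent.part_eq (ha : PolyEvent d a) (r : Fin 2) :
    PolyRel FiniteHistory.encode d (fun H v => (a H v).1 = r) :=
  (PolyRel.eq ha.part (.const r)).congr fun _ _ => Fin.ext_iff

theorem PolyEvent.sessionLt (ha : PolyEvent d a) (hb : PolyEvent d b) :
    PolyRel FiniteHistory.encode d (fun H v => H.hist.SessionLt (a H v) (b H v)) :=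
  ((PolyRel.eq_fin ha.txn hb.txn).and (.lt ha.part hb.part)).or (ha.txn.so hb.txn)

theorem PolyEvent.evLt (ha : PolyEvent d a) (hb : PolyEvent d b) :
    PolyRel FiniteHistory.encode d (fun H v => H.hist.EvLt (a H v) (b H v)) :=
  ((PolyRel.eq_fin ha.txn hb.txn).and (.lt ha.part hb.part)).or
    ((ha.txn.so hb.txn).or (ha.txn.wr hb.txn))

theorem PolyEvent.readForbids (ha : PolyEvent d a) (hb : PolyEvent d b) (hc : PolyEvent d c)
    (r : Fin 2) : PolyRel FiniteHistory.encode d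
      (fun H v => H.hist.ReadForbids r (a H v) (b H v) (c H v)) :=
  ((ha.part_eq 1).and ((hb.part_eq 1).and (hc.part_eq r))).and
    ((PolyRel.eq_fin ha.txn hb.txn).not.and (ha.txn.wrOn_writes hc.txn hb.txn))

theorem PolyEvent.conflictForbids (ha : PolyEvent d a) (hb : PolyEvent d b)
    (hc : PolyEvent d c) : PolyRel FiniteHistory.encode d
      (fun H v => H.hist.ConflictForbids (a H v) (b H v) (c H v)) :=
  ((ha.part_eq 0).and ((hb.part_eq 1).and (hc.part_eq 1))).and
    ((PolyRel.eq_fin ha.txn hc.txn).and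
      ((PolyRel.eq_fin hb.txn hc.txn).not.and (hb.txn.writes_writes hc.txn)))

theorem PolyEvent.forbids (X : Criterion) (ha : PolyEvent d a) (hb : PolyEvent d b)
    (hc : PolyEvent d c) : PolyRel FiniteHistory.encode d
      (fun H v => H.hist.Forbids X (a H v) (b H v) (c H v)) :=
  match X with
  | .PC => ha.readForbids hb hc 0
  | .SI => (ha.readForbids hb hc 0).or (ha.conflictForbids hb hc)
  | .SER => ha.readForbids hb hc 1

theorem PolyTxn.eq_init {f : ∀ H : FiniteHistory, (Fin d → ℕ) → Fin H.n} (hf : PolyTxn d f) :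
    PolyRel FiniteHistory.encode d (fun H v => f H v = H.hist.init) :=
  PolyRel.eq_fin (g := fun H _ => H.hist.init) hf polyFn_init

theorem PolyTxn.sameSession {f g : ∀ H : FiniteHistory, (Fin d → ℕ) → Fin H.n}
    (hf : PolyTxn d f) (hg : PolyTxn d g) :
    PolyRel FiniteHistory.encode d (fun H v => H.hist.SameSession (f H v) (g H v)) :=
  (PolyRel.eq_fin hf hg).or (hf.eq_init.not.and (hg.eq_init.not.and ((hf.so hg).or (hg.so hf))))

theorem PolyState.selected (hs : PolyState d s)
    {f : ∀ H : FiniteHistory, (Fin d → ℕ) → Fin H.n} (hf : PolyTxn d f) :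
    PolyRel FiniteHistory.encode d (fun H v => H.hist.Selected (s H v) (f H v)) :=
  hf.eq_init.or (.exists_const fun i => (hs i).txn.sameSession hf)

theorem PolyState.done (hp : PolyState d p) (ha : PolyEvent d a) :
    PolyRel FiniteHistory.encode d (fun H v => H.hist.Done (p H v) (a H v)) :=
  .exists_const fun i => (ha.eq (hp i)).or (ha.sessionLt (hp i))

theorem polySize_events : PolySize FiniteHistory.encode (fun H => 2 * H.n) :=
  (PolySize.const two_pos).mul polySize_n

theorem polyEvent_decode {u : ∀ H : FiniteHistory, (Fin d → ℕ) → Fin (2 * H.n)}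
    (hu : PolyFn FiniteHistory.encode d (fun H v => (u H v : ℕ))) :
    PolyEvent d (fun H v => finProdFinEquiv.symm (u H v)) where
  part := hu.div (polySize_events.polyBounded_val u) (polySize_n.fn d) polySize_n.polyBounded
    fun H _ => H.n_pos
  txn := hu.mod (polySize_events.polyBounded_val u) (polySize_n.fn d) polySize_n.polyBounded
    fun H _ => H.n_pos

theorem PolyRel.exists_event
    {R : ∀ H : FiniteHistory, (Fin d → ℕ) → History.Event (Fin H.n) → Prop}
    (h : ∀ e : ∀ H : FiniteHistory, (Fin (d + 1) → ℕ) → History.Event (Fin H.n),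
      PolyEvent (d + 1) e →
        PolyRel FiniteHistory.encode (d + 1) (fun H v => R H (fun i => v i.succ) (e H v))) :
    PolyRel FiniteHistory.encode d (fun H v => ∃ e, R H v e) :=
  (PolyRel.exists_fin polySize_events (R := fun H v u => R H v (finProdFinEquiv.symm u))
    (h _ (polyEvent_decode (polySize_events.clamp (.var 0))))).congr fun _ _ =>
      finProdFinEquiv.symm.surjective.exists

theorem PolyRel.forall_event
    {R : ∀ H : FiniteHistory, (Fin d → ℕ) → History.Event (Fin H.n) → Prop}
    (h : ∀ e : ∀ H : FiniteHistory, (Fin (d + 1) → ℕ) → History.Event (Fin H.n),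
      PolyEvent (d + 1) e →
        PolyRel FiniteHistory.encode (d + 1) (fun H v => R H (fun i => v i.succ) (e H v))) :
    PolyRel FiniteHistory.encode d (fun H v => ∀ e, R H v e) :=
  (PolyRel.exists_event (R := fun H v e => ¬ R H v e) fun e he => (h e he).not).not.congr
    fun _ _ => by simp

theorem PolyState.step (X : Criterion) (hs : PolyState d s) (hp : PolyState d p)
    (hq : PolyState d q) : PolyRel FiniteHistory.encode d
      (fun H v => H.hist.Step X (s H v) (p H v) (q H v)) := by
  refine .exists_const fun i => .exists_event fun e he => ?_
  have hs := hs.weaken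
  have hp := hp.weaken
  have hq := hq.weaken
  refine ((hs.selected he.txn).and ((hp.done he).not.and ((hp i).sessionLt he))).and
    (.and ?_ (.and ?_ ?_))
  · exact .forall_event fun a ha => (hs.weaken.selected ha.txn).imp
      ((ha.evLt he.weaken).imp (hp.weaken.done ha))
  · refine .forall_event fun a ha => .forall_event fun c hc => ?_
    have ha := ha.weaken
    have he := he.weaken.weaken
    have hs := hs.weaken.weaken
    have hp := hp.weaken.weaken
    exact (hs.selected ha.txn).imp ((hs.selected hc.txn).imp ((PolyEvent.forbids X ha he hc).imp
      ((hp.done ha).imp ((hp.done hc).or (hc.eq he)))))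
  · refine .forall_const fun j => ?_
    by_cases hj : j = i
    · simpa only [hj, if_true] using (hq i).eq he
    · simpa only [hj, if_false] using (hq j).eq (hp j)

end

/-- The numbering of the tuples of events. -/
def stateEquiv (K n : ℕ) : Fin ((2 * n) ^ K) ≃ (Fin K → History.Event (Fin n)) :=
  finFunctionFinEquiv.symm.trans (Equiv.piCongrRight fun _ => finProdFinEquiv.symm)

theorem polySize_states (K : ℕ) : PolySize FiniteHistory.encode (fun H => (2 * H.n) ^ K) :=
  polySize_events.pow K

theorem polyState_decode {u : ∀ H : FiniteHistory, (Fin d → ℕ) → Fin ((2 * H.n) ^ K)}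
    (hu : PolyFn FiniteHistory.encode d (fun H v => (u H v : ℕ))) :
    PolyState d (fun H v => stateEquiv K H.n (u H v)) := fun i =>
  polyEvent_decode (u := fun H v => finFunctionFinEquiv.symm (u H v) i)
    ((hu.div ((polySize_states K).polyBounded_val u) ((polySize_states i).fn d)
      (polySize_states i).polyBounded fun H _ => (polySize_states i).pos H).mod
      (((polySize_states K).polyBounded_val u).mono fun _ _ => Nat.div_le_self _ _)
      (polySize_events.fn d) polySize_events.polyBounded fun H _ => polySize_events.pos H)

theorem PolyRel.exists_state
    {R : ∀ H : FiniteHistory, (Fin d → ℕ) → (Fin K → History.Event (Fin H.n)) → Prop}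
    (h : PolyRel FiniteHistory.encode (d + 1) (fun H v => R H (fun i => v i.succ)
      (stateEquiv K H.n (clamp ((polySize_states K).pos H) (v 0))))) :
    PolyRel FiniteHistory.encode d (fun H v => ∃ p, R H v p) :=
  (PolyRel.exists_fin (polySize_states K) (R := fun H v u => R H v (stateEquiv K H.n u))
    h).congr fun H _ => (stateEquiv K H.n).surjective.exists

open Relation in
theorem PolyState.completable (X : Criterion)
    {s : ∀ H : FiniteHistory, (Fin d → ℕ) → Fin K → History.Event (Fin H.n)}
    (hs : PolyState d s) :
    PolyRel FiniteHistory.encode d (fun H v => H.hist.Completable X (s H v)) := by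
  let var (j : Fin (d + 2)) (H : FiniteHistory) (v : Fin (d + 2) → ℕ) : Fin ((2 * H.n) ^ K) :=
    clamp ((polySize_states K).pos H) (v j)
  have hvar : ∀ j, PolyFn FiniteHistory.encode (d + 2) (fun H v => (var j H v : ℕ)) :=
    fun j => (polySize_states K).clamp (.var j)
  have hinit : PolyEvent (d + 2) (fun H _ => ((1, H.hist.init) : History.Event (Fin H.n))) :=
    ⟨.const 1, polyFn_init⟩
  refine (PolyRel.exists_fin (polySize_states K) (R := fun H v u => ∃ w,
    (∀ i, stateEquiv K H.n u i = (1, H.hist.init)) ∧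
    ReflTransGen (fun u w => H.hist.Step X (s H v) (stateEquiv K H.n u) (stateEquiv K H.n w)) u w ∧
    ∀ a, H.hist.Selected (s H v) a.2 → H.hist.Done (stateEquiv K H.n w) a)
    (.exists_fin (polySize_states K) (.and (.forall_const fun i =>
      (polyState_decode (hvar 1) i).eq hinit) (.and ?_ ?_)))).congr fun H v => ?_
  · exact .reach_fin (polySize_states K) (hvar 1) (hvar 0) (PolyState.step X
      hs.weaken.weaken.weaken.weaken (polyState_decode ((polySize_states K).clamp (.var 0)))
      (polyState_decode ((polySize_states K).clamp (.var 1))))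
  · exact .forall_event fun a ha => (hs.weaken.weaken.weaken.selected ha.txn).imp
      ((polyState_decode (hvar 0)).weaken.done ha)
  · constructor
    · rintro ⟨p, hp, hfull⟩
      refine ⟨(stateEquiv K H.n).symm H.hist.startState, (stateEquiv K H.n).symm p, fun i => ?_,
        hp.lift _ fun a b hab => ?_, ?_⟩
      · simp [History.startState]
      · simpa [Function.onFun] using hab
      · simpa using hfull
    · rintro ⟨u, w, hu, hr, hfull⟩
      refine ⟨stateEquiv K H.n w, ?_, hfull⟩
      have : H.hist.startState = stateEquiv K H.n u := (funext hu).symm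
      rw [this]
      exact hr.lift _ fun a b hab => hab

theorem polyRel_forall_completable (X : Criterion) (K : ℕ) :
    PolyRel FiniteHistory.encode 0
      (fun H _ => ∀ s : Fin K → History.Event (Fin H.n), H.hist.Completable X s) :=
  (PolyRel.exists_state (R := fun H _ s => ¬ H.hist.Completable X s)
    (PolyState.completable X (polyState_decode ((polySize_states K).clamp (.var 0)))).not).not.congr
    fun _ _ => by simp

theorem PolyRel.decidableInPolyTimeOn {α : Type*} {enc : α → List ℕ} {R : α → Prop}
    (hR : PolyRel enc 0 (fun x _ => R x)) {P Q : α → Prop} (h : ∀ x, P x → (Q x ↔ R x)) :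
    DecidableInPolyTimeOn enc P Q := by
  obtain ⟨p, hp⟩ := hR
  obtain ⟨c, hc⟩ := hp Fin.elim0 2 le_rfl fun i => i.elim0
  refine ⟨c, p, fun x hx => ?_⟩
  obtain ⟨m, t, he, ht, -, hm⟩ := hc x (input (enc x)) ⟨rfl, rfl⟩
  exact ⟨m, t, he, ht, fun hQ => by simp [hm, (h x hx).1 hQ],
    fun hQ => by simp [hm, mt (h x hx).2 hQ]⟩

end RAM

theorem mainTheorem8 (k : ℕ) (X : Criterion) :
    RAM.DecidableInPolyTimeOn FiniteHistory.encode
        (fun H => H.hist.SessionsAreSequences ∧ BiconnectedComponentsBounded H.hist.comm k)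
        (fun H => H.hist.Satisfies X) ∧
      RAM.DecidableInPolyTimeOn FiniteHistory.encode
        (fun H => H.hist.SessionsAreSequences ∧ BiconnectedComponentsBounded H.hist.properComm k)
        (fun H => H.hist.Satisfies X) :=
  ⟨(RAM.polyRel_forall_completable X (k + 1)).decidableInPolyTimeOn fun _ hH =>
      History.satisfies_iff_forall_completable hH.1 (SimpleGraph.BiconnectedSetsBounded.induce
        (fun _ hW => SimpleGraph.encard_le_of_isBiconnected_induce hH.2 hW) _),
    (RAM.polyRel_forall_completable X (k + 1)).decidableInPolyTimeOn fun _ hH =>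
      History.satisfies_iff_forall_completable hH.1
        fun _ hW => SimpleGraph.encard_le_of_isBiconnected_induce hH.2 hW⟩
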